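/- Let $\mathbb{D}=\{z\in\mathbb{C}:|z|<1\}$ and $\mathbb{D}_r=\{|z|<r\}$. Let $\mathcal{M}(1)$ be the class of harmonic functions $f=h+\overline{g}$ in $\mathbb{D}$, with $h,g$ analytic in $\mathbb{D}$ and $h(0)=g(0)=0$, $h'(0)=1$, such that for all $z\in\mathbb{D}$ \[ g'(z)=z\,h'(z),\qquad h'(z)\neq 0,\qquad \operatorname{Re}\Bigl(1+\frac{z h''(z)}{h'(z)}\Bigr)>-\frac12 . \] A starlike domain is an open set containing $0$ and, with each of its points $w$, the segment from $0$ to $w$. The radius of starlikeness of a class of functions on $\mathbb{D}$ is the supremum of the $r\in(0,1]$ such that every function of the class maps each disk $\mathbb{D}_\rho$, $0<\rho\le r$, univalently onto a starlike domain; the radius of starlikeness of a single function $f$ is that of $\{f\}$. Put \[ r_0=\frac13\sqrt{\frac13\bigl(37-8\sqrt{10}\bigr)} ,\qquad F(z)=\operatorname{Re}\frac{z}{(1-z)^2}+i\operatorname{Im}\frac{z}{1-z}. \] **Theorem.** The radius of starlikeness $r_S$ of $\mathcal{M}(1)$ satisfies \[ 4\sqrt2-5\;\le\; r_S\;\le\;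 r_0 . \] Moreover, $F\in\mathcal{M}(1)$, the radius of starlikeness of $F$ is exactly $r_0$, and for $0<r\le 1$ the image $F(\mathbb{D}_r)$ is a starlike domain if and only if $r\le r_0$. -/

import Mathlib

namespace HarmonicStarlike

/-- The open disk `|z| < r`; the unit disk is `disk 1`. -/
def disk (r : ℝ) : Set ℂ := Metric.ball (0 : ℂ) r

/-- The class `M(α)`: the harmonic functions `f = h + conj g` on the unit disk, with `h`, `g`
analytic there, normalized by `h(0) = g(0) = 0` and `h'(0) = 1`, such that
`g'(z) = α z h'(z)` and `Re (1 + z h''(z) / h'(z)) > -1/2` for `|z| < 1`. The quotient is required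
to make sense, that is, `h'` has no zero in the unit disk. Only the values of `f` in the unit disk
matter. -/
def classM (α : ℂ) : Set (ℂ → ℂ) :=
  {f | ∃ h g : ℂ → ℂ,
    DifferentiableOn ℂ h (disk 1) ∧ DifferentiableOn ℂ g (disk 1) ∧
    h 0 = 0 ∧ g 0 = 0 ∧ deriv h 0 = 1 ∧
    ∀ z ∈ disk 1,
      f z = h z + (starRingEnd ℂ) (g z) ∧
      deriv g z = α * z * deriv h z ∧
      deriv h z ≠ 0 ∧
      -(1 / 2 : ℝ) < (1 + z * deriv (deriv h) z / deriv h z).re}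

/-- A domain that is starlike with respect to the origin: an open set that contains the origin and,
with each of its points, the segment from the origin to that point. (Such a set is connected.) -/
def IsStarlikeDomain (s : Set ℂ) : Prop :=
  IsOpen s ∧ (0 : ℂ) ∈ s ∧ StarConvex ℝ (0 : ℂ) s

/-- `f` is univalent in the disk `|z| < r` and maps it onto a starlike domain. -/
def IsStarlikeOnDisk (f : ℂ → ℂ) (r : ℝ) : Prop :=
  Set.InjOn f (disk r) ∧ IsStarlikeDomain (f '' disk r)

/-- The radius of starlikeness of a class of functions on the unit disk: the supremum of the
`r ∈ (0, 1]` such that every function of the class maps each disk `|z| < ρ`, `0 < ρ ≤ r`,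
univalently onto a starlike domain. All `ρ ≤ r` are asked for, since for harmonic mappings
starlikeness on a disk does not pass to smaller disks. -/
noncomputable def radiusOfStarlikeness (𝓕 : Set (ℂ → ℂ)) : ℝ :=
  sSup {r : ℝ | 0 < r ∧ r ≤ 1 ∧ ∀ f ∈ 𝓕, ∀ ρ : ℝ, 0 < ρ → ρ ≤ r → IsStarlikeOnDisk f ρ}

/-- The map `F(z) = Re (z / (1 - z)^2) + i Im (z / (1 - z))`. -/
noncomputable def mapF (z : ℂ) : ℂ :=
  ((z / (1 - z) ^ 2).re : ℂ) + Complex.I * ((z / (1 - z)).im : ℂ)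

end HarmonicStarlike

namespace HarmonicStarlike

open Set Filter Topology Complex MeasureTheory

/-! Lower bound. A local diffeomorphism `f` of a disk with `f 0 = 0` is univalent and starlike there
once the lifts of rays move outwards. For a sense-preserving `f = h + conj g` this means `Re ((z h'
- conj (z g')) conj f) > 0` for z ≠ 0 (`isStarlikeOnDisk_of_harmonic`). A unimodular λ chosen at
each point reduces it to `Re (z F' conj F) > 0` for the analytic functions F = h + λ g, |λ| ≤ 1
(`re_harmonic_pos_of_stable`).

Write h' = q³. Then ζ q(ζ) is starlike of order 1/2, a property that survives the Koebe transform Q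
of q at z, so Re Q > 1/2 (`koebe_re_gt`). Integrating F' = (1 + λ w) q³ along the radius gives F(z)
= (1 - |z|²) z F'(z) J with J = ∫₀¹ (1 - t u) Q(-t z)³ dt and |u| ≤ |z|, so Re J > 0 is what is
needed. By Herglotz each factor Q(-t z) is an average of kernels 1 / (1 - t w), and Feynman
parameters merge three kernels into the cube of one. The integral is then (1 - (u + w)/2) / (1 -
w)², whose real part is positive for |u|, |w| ≤ r < 1 as soon as r² + 10 r - 7 < 0, that is, r < 4
√2 - 5 (`re_extremal_pos`).

Upper bound. In the coordinate z / (1 - z) the map F of the statement is elementary, and F(𝔻_r) is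
the region `regionF σ` with σ = ((1 - r²) / (1 + r²))². Along a ray the defining function is a
quartic polynomial; the sign of its derivative at its zeros shows that the image is starlike exactly
for σ ≥ 5/32, that is, for r ≤ r₀. As F lies in the class, r₀ bounds the radius of the class. -/

/-! ### Lifting rays: a criterion for univalence and starlikeness -/

theorem eventually_lt_left_of_hasDerivAt_pos {φ : ℝ → ℝ} {d t : ℝ} (hφ : HasDerivAt φ d t)
    (hd : 0 < d) : ∀ᶠ s in 𝓝[<] t, φ s < φ t := by
  have h : ∀ᶠ s in 𝓝[<] t, 0 < slope φ t s :=
    ((hasDerivAt_iff_tendsto_slope.1 hφ).mono_left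
      (nhdsWithin_mono _ fun s hs => ne_of_lt hs)).eventually (lt_mem_nhds hd)
  filter_upwards [h, self_mem_nhdsWithin] with s hs hst
  have hst : s - t < 0 := sub_neg.2 hst
  rw [slope_def_field, div_pos_iff] at hs
  rcases hs with h | h <;> linarith

theorem eventually_lt_right_of_hasDerivAt_neg {φ : ℝ → ℝ} {d t : ℝ} (hφ : HasDerivAt φ d t)
    (hd : d < 0) : ∀ᶠ s in 𝓝[>] t, φ s < φ t := by
  have h : ∀ᶠ s in 𝓝[>] t, slope φ t s < 0 :=
    ((hasDerivAt_iff_tendsto_slope.1 hφ).mono_left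
      (nhdsWithin_mono _ fun s hs => ne_of_gt hs)).eventually (gt_mem_nhds hd)
  filter_upwards [h, self_mem_nhdsWithin] with s hs hst
  have hst : 0 < s - t := sub_pos.2 hst
  rw [slope_def_field, div_neg_iff] at hs
  rcases hs with h | h <;> linarith

/-- A local inverse lifts the ray `s ↦ s • w` to a curve through `z`; if the lifted ray points
outwards at `z`, the curve lies closer to the origin just before it reaches `z`. -/
theorem exists_lift_left {f : ℂ → ℂ} {z w : ℂ} {t : ℝ} {L : ℂ ≃L[ℝ] ℂ}
    (hf : HasStrictFDerivAt f (L : ℂ →L[ℝ] ℂ) z) (ht : f z = t • w)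
    (hpos : 0 < inner ℝ z (L.symm w)) :
    ∃ γ : ℝ → ℂ, γ t = z ∧ ContinuousAt γ t ∧
      ∀ᶠ s in 𝓝[<] t, f (γ s) = s • w ∧ ‖γ s‖ < ‖z‖ := by
  set ψ := hf.localInverse f L z with hψ
  have hψz : ψ (f z) = z := hf.localInverse_apply_image
  have hd : HasDerivAt (fun s : ℝ => ψ (s • w)) (L.symm w) t := by
    have h1 : HasFDerivAt ψ (L.symm : ℂ →L[ℝ] ℂ) (t • w) := by
      rw [← ht]; exact hf.to_localInverse.hasFDerivAt
    have h2 : HasDerivAt (fun s : ℝ => s • w) w t := by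
      simpa using (hasDerivAt_id t).smul_const w
    exact h1.comp_hasDerivAt t h2
  have hγt : ψ (t • w) = z := by rw [← ht, hψz]
  refine ⟨fun s => ψ (s • w), hγt, hd.continuousAt, ?_⟩
  have h1 : ∀ᶠ s in 𝓝 t, f (ψ (s • w)) = s • w := by
    have h2 : Tendsto (fun s : ℝ => s • w) (𝓝 t) (𝓝 (f z)) := by
      rw [ht]; exact (continuous_id.smul continuous_const).tendsto t
    exact h2.eventually hf.eventually_right_inverse
  have h3 : HasDerivAt (fun s : ℝ => ‖ψ (s • w)‖ ^ 2) (2 * inner ℝ z (L.symm w)) t := by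
    have := hd.norm_sq
    rwa [hγt] at this
  have h4 := eventually_lt_left_of_hasDerivAt_pos h3 (by positivity)
  filter_upwards [h1.filter_mono nhdsWithin_le_nhds, h4] with s hs1 hs4
  rw [hγt] at hs4
  exact ⟨hs1, lt_of_pow_lt_pow_left₀ 2 (norm_nonneg _) hs4⟩

section Criterion

variable {f : ℂ → ℂ} {R : ℝ} {L : ℂ → ℂ ≃L[ℝ] ℂ}

theorem exists_lift_left_of_radial
    (hf : ∀ z ∈ Metric.ball (0 : ℂ) R, HasStrictFDerivAt f (L z : ℂ →L[ℝ] ℂ) z)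
    (hpos : ∀ z ∈ Metric.ball (0 : ℂ) R, z ≠ 0 → 0 < inner ℝ z ((L z).symm (f z)))
    {z w : ℂ} {t : ℝ} (hz : z ∈ Metric.ball (0 : ℂ) R) (hz0 : z ≠ 0) (ht0 : 0 < t)
    (ht : f z = t • w) :
    ∃ γ : ℝ → ℂ, γ t = z ∧ ContinuousAt γ t ∧
      ∀ᶠ s in 𝓝[<] t, f (γ s) = s • w ∧ ‖γ s‖ < ‖z‖ := by
  refine exists_lift_left (hf z hz) ht ?_
  have := hpos z hz hz0
  rw [ht, map_smul, inner_smul_right] at this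
  exact pos_of_mul_pos_right this ht0.le

theorem eq_zero_of_radial
    (hpos : ∀ z ∈ Metric.ball (0 : ℂ) R, z ≠ 0 → 0 < inner ℝ z ((L z).symm (f z)))
    {z : ℂ} (hz : z ∈ Metric.ball (0 : ℂ) R) (hfz : f z = 0) : z = 0 := by
  by_contra h
  have := hpos z hz h
  simp [hfz] at this

/-- Take the least parameter in `[t, 1]` whose point on the ray has a preimage in the compact ball.
If it exceeded `t`, the lift to the left would give a smaller one, with a preimage still in the ball
because its norm decreases. -/
theorem smul_mem_image_closedBall_of_radial (h0 : f 0 = 0)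
    (hf : ∀ z ∈ Metric.ball (0 : ℂ) R, HasStrictFDerivAt f (L z : ℂ →L[ℝ] ℂ) z)
    (hpos : ∀ z ∈ Metric.ball (0 : ℂ) R, z ≠ 0 → 0 < inner ℝ z ((L z).symm (f z)))
    {z₀ : ℂ} (hz₀ : z₀ ∈ Metric.ball (0 : ℂ) R) {t : ℝ} (ht0 : 0 ≤ t) (ht1 : t ≤ 1) :
    t • f z₀ ∈ f '' Metric.closedBall 0 ‖z₀‖ := by
  have hsub : Metric.closedBall (0 : ℂ) ‖z₀‖ ⊆ Metric.ball 0 R :=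
    Metric.closedBall_subset_ball (by simpa using hz₀)
  by_cases hz00 : z₀ = 0
  · exact ⟨0, by simp, by simp [hz00, h0]⟩
  have hw : f z₀ ≠ 0 := fun h => hz00 (eq_zero_of_radial hpos hz₀ h)
  by_contra hcon
  have hcomp : IsCompact (f '' Metric.closedBall 0 ‖z₀‖) :=
    (isCompact_closedBall _ _).image_of_continuousOn fun z hz =>
      (hf z (hsub hz)).hasFDerivAt.continuousAt.continuousWithinAt
  set T : Set ℝ := Icc t 1 ∩ (fun s : ℝ => s • f z₀) ⁻¹' (f '' Metric.closedBall 0 ‖z₀‖)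
  have hT : IsCompact T :=
    isCompact_Icc.inter_right (hcomp.isClosed.preimage (by fun_prop))
  have h1T : (1 : ℝ) ∈ T := ⟨⟨ht1, le_rfl⟩, z₀, by simp, by simp⟩
  obtain ⟨m, ⟨⟨hm1, hm2⟩, z, hz, hzm⟩, hmin⟩ := hT.exists_isLeast ⟨1, h1T⟩
  have htm : t < m := lt_of_le_of_ne hm1 fun h => hcon ⟨z, hz, by rw [hzm, h]⟩
  have hm0 : 0 < m := ht0.trans_lt htm
  have hz0 : z ≠ 0 := by
    rintro rfl
    rw [h0] at hzm
    exact (smul_ne_zero hm0.ne' hw) hzm.symm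
  obtain ⟨γ, -, -, hγ⟩ := exists_lift_left_of_radial hf hpos (hsub hz) hz0 hm0 hzm
  obtain ⟨s, ⟨hs1, hs2⟩, hs3⟩ := (hγ.and (Ioo_mem_nhdsLT htm)).exists
  have : s ∈ T := ⟨⟨hs3.1.le, hs3.2.le.trans hm2⟩, γ s, by
    have : ‖z‖ ≤ ‖z₀‖ := by simpa using hz
    simpa using hs2.le.trans this, hs1⟩
  exact absurd (hmin this) (not_le.2 hs3.2)

/-- Two distinct preimages of one point are pulled back together along its ray: the two lifts stay
in the closed ball and, near the parameter where they start, stay distinct. So no least parameter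
with two distinct preimages exists, whereas compactness provides one; it is positive because `f`
vanishes only at 0. -/
theorem injOn_ball_of_radial (h0 : f 0 = 0)
    (hf : ∀ z ∈ Metric.ball (0 : ℂ) R, HasStrictFDerivAt f (L z : ℂ →L[ℝ] ℂ) z)
    (hpos : ∀ z ∈ Metric.ball (0 : ℂ) R, z ≠ 0 → 0 < inner ℝ z ((L z).symm (f z))) :
    InjOn f (Metric.ball 0 R) := by
  intro a ha b hb hab
  by_contra hne
  set r := max ‖a‖ ‖b‖
  have hsub : Metric.closedBall (0 : ℂ) r ⊆ Metric.ball 0 R :=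
    Metric.closedBall_subset_ball (max_lt (by simpa using ha) (by simpa using hb))
  set w := f a with hw
  -- For points of the ball with equal values, lying in `V` amounts to x = y: local injectivity puts
  -- the diagonal in `V`, and injectivity keeps distinct points out. As `V` is open, this makes "x ≠
  -- y" a closed condition and `K` compact.
  set V : Set (ℝ × ℂ × ℂ) := {p | ∃ u : Set ℂ, IsOpen u ∧ InjOn f u ∧ p.2.1 ∈ u ∧ p.2.2 ∈ u}
  have hV : IsOpen V := by
    rw [isOpen_iff_mem_nhds]
    rintro p ⟨u, hu, hinj, h1, h2⟩
    filter_upwards [(hu.preimage (by fun_prop : Continuous fun p : ℝ × ℂ × ℂ => p.2.1)).mem_nhds h1,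
      (hu.preimage (by fun_prop : Continuous fun p : ℝ × ℂ × ℂ => p.2.2)).mem_nhds h2]
      with q hq1 hq2 using ⟨u, hu, hinj, hq1, hq2⟩
  have hcf : ContinuousOn f (Metric.closedBall 0 r) := fun z hz =>
    (hf z (hsub hz)).hasFDerivAt.continuousAt.continuousWithinAt
  set B : Set (ℝ × ℂ × ℂ) := Icc (0 : ℝ) 1 ×ˢ Metric.closedBall (0 : ℂ) r ×ˢ
    Metric.closedBall (0 : ℂ) r
  have hB : IsCompact B :=
    isCompact_Icc.prod ((isCompact_closedBall _ _).prod (isCompact_closedBall _ _))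
  have hB1 : ContinuousOn (fun p : ℝ × ℂ × ℂ => f p.2.1 - p.1 • w) B :=
    (hcf.comp (by fun_prop) fun p hp => hp.2.1).sub (by fun_prop)
  have hB2 : ContinuousOn (fun p : ℝ × ℂ × ℂ => f p.2.2 - p.1 • w) B :=
    (hcf.comp (by fun_prop) fun p hp => hp.2.2).sub (by fun_prop)
  set K : Set (ℝ × ℂ × ℂ) := (B ∩ {p | f p.2.1 - p.1 • w = 0}) ∩
    (B ∩ {p | f p.2.2 - p.1 • w = 0}) ∩ Vᶜ
  have hK : IsCompact K := by
    refine IsCompact.inter_right (IsCompact.inter ?_ ?_) hV.isClosed_compl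
    · exact hB.of_isClosed_subset
        (hB1.preimage_isClosed_of_isClosed hB.isClosed isClosed_singleton) inter_subset_left
    · exact hB.of_isClosed_subset
        (hB2.preimage_isClosed_of_isClosed hB.isClosed isClosed_singleton) inter_subset_left
  have hKmem : ∀ {t : ℝ} {x y : ℂ}, (t, x, y) ∈ B → f x = t • w → f y = t • w → x ≠ y →
      (t, x, y) ∈ K := by
    intro t x y hm hx hy hxy
    refine ⟨⟨⟨hm, sub_eq_zero.2 hx⟩, hm, sub_eq_zero.2 hy⟩, ?_⟩
    rintro ⟨u, -, hinj, h1, h2⟩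
    exact hxy (hinj h1 h2 (hx.trans hy.symm))
  have h1K : ((1 : ℝ), a, b) ∈ K :=
    hKmem ⟨by simp, by simp [r], by simp [r]⟩ (by simp [hw]) (by rw [one_smul, hab]) hne
  obtain ⟨⟨m, x, y⟩, hmK, hmin⟩ := hK.exists_isMinOn ⟨_, h1K⟩ continuous_fst.continuousOn
  obtain ⟨⟨⟨hmB, hx⟩, -, hy⟩, hmV⟩ := hmK
  have hx' : f x = m • w := sub_eq_zero.1 hx
  have hy' : f y = m • w := sub_eq_zero.1 hy
  obtain ⟨⟨hm0, hm1⟩, hxB, hyB⟩ := hmB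
  simp only at hm0 hm1 hxB hyB
  have hxy : x ≠ y := by
    rintro rfl
    have h := (hf x (hsub hxB)).eventually_left_inverse
    obtain ⟨u, hu, huo, hxu⟩ := eventually_nhds_iff.1 h
    refine hmV ⟨u, huo, fun p hp q hq hpq => ?_, hxu, hxu⟩
    rw [← hu p hp, ← hu q hq, hpq]
  have hzero : f x ≠ 0 := fun h => hxy <| by
    rw [eq_zero_of_radial hpos (hsub hxB) h, eq_zero_of_radial hpos (hsub hyB) (by
      rw [hy', ← hx', h])]
  have hx0 : x ≠ 0 := by rintro rfl; exact hzero h0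
  have hy0 : y ≠ 0 := by rintro rfl; exact hzero (by rw [hx', ← hy', h0])
  have hmpos : 0 < m := lt_of_le_of_ne hm0 fun h => hzero (by rw [hx', ← h, zero_smul])
  obtain ⟨γ, hγ1, hγ2, hγ3⟩ := exists_lift_left_of_radial hf hpos (hsub hxB) hx0 hmpos hx'
  obtain ⟨δ, hδ1, hδ2, hδ3⟩ := exists_lift_left_of_radial hf hpos (hsub hyB) hy0 hmpos hy'
  have hne' : ∀ᶠ s in 𝓝[<] m, γ s ≠ δ s := by
    have h : ∀ᶠ s in 𝓝 m, (γ - δ) s ≠ 0 := (hγ2.sub hδ2).eventually_ne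
      (by simpa [hγ1, hδ1, sub_eq_zero] using hxy)
    filter_upwards [h.filter_mono nhdsWithin_le_nhds] with s hs using sub_ne_zero.1 hs
  obtain ⟨s, ⟨⟨hs1, hs2⟩, hs3⟩, hs4⟩ :=
    (((hγ3.and hδ3).and hne').and (Ioo_mem_nhdsLT hmpos)).exists
  have hxr : ‖x‖ ≤ r := by simpa using hxB
  have hyr : ‖y‖ ≤ r := by simpa using hyB
  have hsK : (s, γ s, δ s) ∈ K :=
    hKmem ⟨⟨hs4.1.le, hs4.2.le.trans hm1⟩, by simpa using hs1.2.le.trans hxr,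
      by simpa using hs2.2.le.trans hyr⟩ hs1.1 hs2.1 hs3
  exact absurd (hmin hsK) (not_le.2 hs4.2)

theorem isStarlikeOnDisk_of_radial (h0 : f 0 = 0)
    (hf : ∀ z ∈ Metric.ball (0 : ℂ) R, HasStrictFDerivAt f (L z : ℂ →L[ℝ] ℂ) z)
    (hpos : ∀ z ∈ Metric.ball (0 : ℂ) R, z ≠ 0 → 0 < inner ℝ z ((L z).symm (f z)))
    {ρ : ℝ} (hρ : 0 < ρ) (hρR : ρ ≤ R) : IsStarlikeOnDisk f ρ := by
  have hsub : disk ρ ⊆ Metric.ball 0 R := Metric.ball_subset_ball hρR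
  refine ⟨(injOn_ball_of_radial h0 hf hpos).mono hsub, ?_, ⟨0, by simpa [disk] using hρ, h0⟩, ?_⟩
  · rw [isOpen_iff_mem_nhds]
    rintro _ ⟨z, hz, rfl⟩
    rw [← (hf z (hsub hz)).map_nhds_eq_of_equiv]
    exact image_mem_map (Metric.isOpen_ball.mem_nhds hz)
  · rw [starConvex_zero_iff]
    rintro _ ⟨z, hz, rfl⟩ t ht0 ht1
    refine image_mono ?_ (smul_mem_image_closedBall_of_radial h0 hf hpos (hsub hz) ht0 ht1)
    exact Metric.closedBall_subset_ball (by simpa [disk] using hz)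

end Criterion

/-! ### Harmonic maps and the analytic functions h + λ g -/

theorem exists_equiv_of_norm_lt {a b : ℂ} (hab : ‖b‖ < ‖a‖) :
    ∃ L : ℂ ≃L[ℝ] ℂ, ∀ v, L v = a * v + (starRingEnd ℂ) (b * v) := by
  let A : ℂ →ₗ[ℝ] ℂ :=
    { toFun := fun v => a * v + (starRingEnd ℂ) (b * v)
      map_add' := fun x y => by simp only [mul_add, map_add]; ring
      map_smul' := fun c x => by
        simp only [real_smul, map_mul, conj_ofReal, RingHom.id_apply]; ring }
  have hA : Function.Injective A := by
    rw [← LinearMap.ker_eq_bot, LinearMap.ker_eq_bot']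
    intro v hv
    by_contra hv0
    have h1 : a * v = -(starRingEnd ℂ) (b * v) := eq_neg_of_add_eq_zero_left hv
    have h2 : ‖a‖ * ‖v‖ = ‖b‖ * ‖v‖ := by
      rw [← norm_mul, h1, norm_neg, norm_conj, norm_mul]
    exact hab.ne' (mul_right_cancel₀ (norm_ne_zero_iff.2 hv0) h2)
  exact ⟨(LinearEquiv.ofInjectiveEndo A hA).toContinuousLinearEquiv, fun v => rfl⟩

/-- A sense-preserving harmonic map `h + conj g` whose argument increases along the circles around
the origin is univalent and starlike in each disk. -/
theorem isStarlikeOnDisk_of_harmonic {h g h' g' : ℂ → ℂ} {R : ℝ} (h0 : h 0 = 0) (g0 : g 0 = 0)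
    (hh : ∀ z ∈ Metric.ball (0 : ℂ) R, HasStrictDerivAt h (h' z) z)
    (hg : ∀ z ∈ Metric.ball (0 : ℂ) R, HasStrictDerivAt g (g' z) z)
    (hlt : ∀ z ∈ Metric.ball (0 : ℂ) R, ‖g' z‖ < ‖h' z‖)
    (hpos : ∀ z ∈ Metric.ball (0 : ℂ) R, z ≠ 0 →
      0 < ((z * h' z - (starRingEnd ℂ) (z * g' z)) *
        (starRingEnd ℂ) (h z + (starRingEnd ℂ) (g z))).re)
    {ρ : ℝ} (hρ : 0 < ρ) (hρR : ρ ≤ R) :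
    IsStarlikeOnDisk (fun z => h z + (starRingEnd ℂ) (g z)) ρ := by
  have hex : ∀ z, ∃ L : ℂ ≃L[ℝ] ℂ, z ∈ Metric.ball (0 : ℂ) R →
      ∀ v, L v = h' z * v + (starRingEnd ℂ) (g' z * v) := by
    intro z
    by_cases hz : z ∈ Metric.ball (0 : ℂ) R
    · obtain ⟨L, hL⟩ := exists_equiv_of_norm_lt (hlt z hz)
      exact ⟨L, fun _ => hL⟩
    · exact ⟨ContinuousLinearEquiv.refl ℝ ℂ, fun h => absurd h hz⟩
  choose L hL using hex
  refine isStarlikeOnDisk_of_radial (R := R) (L := L) (by simp [h0, g0]) ?_ ?_ hρ hρR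
  · intro z hz
    have h1 := (hh z hz).complexToReal_fderiv
    have h2 := (conjCLE : ℂ ≃L[ℝ] ℂ).toContinuousLinearMap.hasStrictFDerivAt.comp z
      (hg z hz).complexToReal_fderiv
    refine (h1.add h2).congr_fderiv ?_
    ext1 v
    simp [hL z hz]
  · intro z hz hz0
    set v := (L z).symm (h z + (starRingEnd ℂ) (g z)) with hv
    have hLv : h' z * v + (starRingEnd ℂ) (g' z * v) = h z + (starRingEnd ℂ) (g z) := by
      rw [← hL z hz, hv, ContinuousLinearEquiv.apply_symm_apply]
    have hp := hpos z hz hz0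
    -- The cross terms z h' g' v and its conjugate have cancelling real parts; only the Jacobian
    -- times the inner product remains.
    have hid : ((z * h' z - (starRingEnd ℂ) (z * g' z)) *
        (starRingEnd ℂ) (h' z * v + (starRingEnd ℂ) (g' z * v))).re =
        (‖h' z‖ ^ 2 - ‖g' z‖ ^ 2) * inner ℝ z v := by
      rw [Complex.inner, ← normSq_eq_norm_sq, ← normSq_eq_norm_sq, normSq_apply, normSq_apply]
      simp only [map_mul, map_add, conj_conj, mul_re, mul_im, sub_re, sub_im, add_re, add_im,
        conj_re, conj_im]
      ring
    rw [← hLv, hid] at hp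
    refine pos_of_mul_pos_right hp ?_
    have := pow_le_pow_left₀ (norm_nonneg _) (hlt z hz).le 2
    linarith

/-- If all the analytic maps `h + λ g`, `|λ| ≤ 1`, are starlike, so is `h + conj g`. Here `A`, `B`
stand for `z h'(z)` and `z g'(z)`. -/
theorem re_harmonic_pos_of_stable {A B h g : ℂ}
    (H : ∀ l : ℂ, ‖l‖ ≤ 1 → 0 < ((A + l * B) * (starRingEnd ℂ) (h + l * g)).re) :
    0 < ((A - (starRingEnd ℂ) B) * (starRingEnd ℂ) (h + (starRingEnd ℂ) g)).re := by
  have hne : ∀ l : ℂ, ‖l‖ ≤ 1 → h + l * g ≠ 0 := fun l hl h0 => by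
    have := H l hl
    simp [h0] at this
  have hlt : ‖g‖ < ‖h‖ := by
    by_contra! hle
    by_cases hg : g = 0
    · have : h = 0 := by simpa [hg] using hle
      exact hne 0 (by simp) (by simp [this])
    · refine hne (-h / g) ?_ (by field_simp; ring)
      rw [norm_div, norm_neg]
      exact div_le_one_of_le₀ hle (norm_nonneg _)
  set f := h + (starRingEnd ℂ) g with hf
  have hf0 : f ≠ 0 := fun h0 => by
    have : h = -(starRingEnd ℂ) g := eq_neg_of_add_eq_zero_left h0
    rw [this, norm_neg, norm_conj] at hlt
    exact lt_irrefl _ hlt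
  have hcf : (starRingEnd ℂ) f ≠ 0 := (map_ne_zero _).2 hf0
  -- For this unimodular λ, h + λ g = (|h|² - |g|²) / conj f, which turns the analytic condition
  -- into the harmonic one up to a positive factor.
  have h1 := H (-f / (starRingEnd ℂ) f) (by
    rw [norm_div, norm_neg, norm_conj, div_self (norm_ne_zero_iff.2 hf0)])
  have h2 : h + -f / (starRingEnd ℂ) f * g =
      ((normSq h - normSq g : ℝ) : ℂ) / (starRingEnd ℂ) f := by
    rw [eq_div_iff hcf, add_mul, mul_right_comm, div_mul_cancel₀ _ hcf, ofReal_sub,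
      normSq_eq_conj_mul_self, normSq_eq_conj_mul_self, hf, map_add, conj_conj]
    ring
  have h3 : (A + -f / (starRingEnd ℂ) f * B) * (starRingEnd ℂ) (h + -f / (starRingEnd ℂ) f * g) =
      (((normSq h - normSq g) / normSq f : ℝ) : ℂ) * (A * (starRingEnd ℂ) f - B * f) := by
    rw [h2, map_div₀, conj_conj, conj_ofReal, ofReal_div, normSq_eq_conj_mul_self (z := f)]
    field_simp
    ring
  rw [h3, re_ofReal_mul] at h1
  have h4 : 0 < (normSq h - normSq g) / normSq f := by
    refine div_pos ?_ (normSq_pos.2 hf0)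
    rw [normSq_eq_norm_sq, normSq_eq_norm_sq, sub_pos]
    exact pow_lt_pow_left₀ hlt (norm_nonneg _) two_ne_zero
  have h5 := pos_of_mul_pos_right h1 h4.le
  have h6 : ((A - (starRingEnd ℂ) B) * (starRingEnd ℂ) f).re = (A * (starRingEnd ℂ) f - B * f).re := by
    simp only [mul_re, sub_re, sub_im, conj_re, conj_im]
    ring
  rw [h6]
  exact h5

/-! ### Jack's lemma and the Marx–Strohhäcker inequality -/

theorem nonpos_of_hasDerivAt_of_nonpos {φ : ℝ → ℝ} {d : ℝ} (hd : HasDerivAt φ d 0) (h0 : φ 0 = 0)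
    (hle : ∀ t ∈ Ioo (0 : ℝ) 1, φ t ≤ 0) : d ≤ 0 := by
  by_contra! hpos
  obtain ⟨t, ht1, ht2⟩ := ((eventually_lt_right_of_hasDerivAt_neg hd.neg (neg_neg_of_pos hpos)).and
    (Ioo_mem_nhdsGT one_pos)).exists
  have := hle t ht2
  simp only [Pi.neg_apply, h0] at ht1
  linarith

/-- Jack's lemma at a boundary point of the disk, with the value of modulus one. -/
theorem jack_boundary {ω : ℂ → ℂ} {z₀ d : ℂ} (hz₀ : z₀ ≠ 0)
    (hω : DifferentiableOn ℂ ω (Metric.ball 0 ‖z₀‖)) (h0 : ω 0 = 0)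
    (hlt : ∀ z ∈ Metric.ball (0 : ℂ) ‖z₀‖, ‖ω z‖ ≤ 1) (h1 : ‖ω z₀‖ = 1)
    (hd : HasDerivAt ω d z₀) : ∃ k : ℝ, 1 ≤ k ∧ z₀ * d = k * ω z₀ := by
  have hr : 0 < ‖z₀‖ := norm_pos_iff.2 hz₀
  have hS : ∀ z ∈ Metric.ball (0 : ℂ) ‖z₀‖, ‖ω z‖ ≤ ‖z‖ / ‖z₀‖ := fun z hz => by
    have := Complex.dist_le_div_mul_dist_of_mapsTo_ball (R₂ := 1) hω
      (fun w hw => by simpa [h0] using hlt w hw) hz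
    simpa [h0, div_eq_inv_mul] using this
  set D := (starRingEnd ℂ) (ω z₀) * (z₀ * d) with hD
  -- Along the spiral z₀ (1 - t) exp(iαt) the Schwarz lemma gives |ω| ≤ 1 - t, with equality at t =
  -- 0. Comparing derivatives there for every slope α forces `D` to be real and at least 1.
  have key : ∀ α : ℝ, (D * (-1 + α * I)).re + 1 ≤ 0 := by
    intro α
    have hcurve : HasDerivAt (fun t : ℝ => z₀ * ((1 - (t : ℂ)) * exp (α * I * t)))
        (z₀ * (-1 + α * I)) 0 := by
      have e1 : HasDerivAt (fun t : ℂ => z₀ * ((1 - t) * exp (α * I * t)))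
          (z₀ * (-1 + α * I)) ((0 : ℝ) : ℂ) := by
        have h2 : HasDerivAt (fun t : ℂ => exp (α * I * t)) (exp (α * I * 0) * (α * I * 1)) 0 :=
          ((hasDerivAt_id (0 : ℂ)).const_mul (α * I)).cexp
        have h3 := (((hasDerivAt_id (0 : ℂ)).const_sub 1).mul h2).const_mul z₀
        rw [ofReal_zero]
        refine h3.congr_deriv ?_
        simp
      exact e1.comp_ofReal
    have hω' : HasDerivAt ω d (z₀ * ((1 - ((0 : ℝ) : ℂ)) * exp (α * I * ((0 : ℝ) : ℂ)))) := by
      simpa using hd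
    have hcomp := ((hω'.comp (0 : ℝ) hcurve).const_mul ((starRingEnd ℂ) (ω z₀)))
    have hre := (reCLM.hasFDerivAt.comp_hasDerivAt (0 : ℝ) hcomp).sub
      ((hasDerivAt_id (0 : ℝ)).const_sub 1)
    have := nonpos_of_hasDerivAt_of_nonpos hre ?_ ?_
    · have e : (starRingEnd ℂ) (ω z₀) * (d * (z₀ * (-1 + α * I))) = D * (-1 + α * I) := by
        rw [hD]; ring
      rw [e, reCLM_apply] at this
      linarith
    · simp [mul_comm _ (ω z₀), mul_conj, normSq_eq_norm_sq, h1]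
    · intro t ht
      have hnorm : ‖z₀ * ((1 - (t : ℂ)) * exp (α * I * t))‖ = ‖z₀‖ * (1 - t) := by
        rw [norm_mul, norm_mul, show (α : ℂ) * I * t = ((α * t : ℝ) : ℂ) * I by push_cast; ring,
          norm_exp_ofReal_mul_I, mul_one, show (1 - (t : ℂ)) = ((1 - t : ℝ) : ℂ) by push_cast; ring,
          norm_real, Real.norm_of_nonneg (by linarith [ht.2])]
      have hmem : z₀ * ((1 - (t : ℂ)) * exp (α * I * t)) ∈ Metric.ball (0 : ℂ) ‖z₀‖ := by
        rw [mem_ball_zero_iff, hnorm]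
        nlinarith [ht.1]
      have h2 := hS _ hmem
      rw [hnorm, mul_div_cancel_left₀ _ hr.ne'] at h2
      have h3 := re_le_norm ((starRingEnd ℂ) (ω z₀) * ω (z₀ * ((1 - (t : ℂ)) * exp (α * I * t))))
      rw [norm_mul, norm_conj, h1, one_mul] at h3
      simp only [Pi.sub_apply, Function.comp_apply, reCLM_apply, id_eq]
      linarith
  have key' : ∀ α : ℝ, -D.re - α * D.im + 1 ≤ 0 := fun α => by
    have := key α
    simp only [mul_re, add_re, add_im, neg_re, neg_im, one_re, one_im, ofReal_re, ofReal_im, I_re,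
      I_im, mul_im] at this
    linarith
  have him : D.im = 0 := by
    by_contra hne
    have := key' (-D.re / D.im)
    rw [div_mul_cancel₀ _ hne] at this
    linarith
  refine ⟨D.re, by linarith [key' 0], ?_⟩
  have hDre : (D.re : ℂ) = D := Complex.ext (by simp) (by simp [him])
  rw [hDre, hD, mul_right_comm, ← normSq_eq_conj_mul_self, normSq_eq_norm_sq, h1]
  simp

/-- The Marx–Strohhäcker inequality, written for the reciprocal. -/
theorem norm_one_sub_lt_one {V : ℂ → ℂ} (hV : DifferentiableOn ℂ V (Metric.ball 0 1))
    (h0 : V 0 = 1) (hne : ∀ z ∈ Metric.ball (0 : ℂ) 1, V z ≠ 0)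
    (hre : ∀ z ∈ Metric.ball (0 : ℂ) 1, (z * deriv V z / V z).re < 1 / 2) {z : ℂ}
    (hz : z ∈ Metric.ball (0 : ℂ) 1) : ‖1 - V z‖ < 1 := by
  by_contra! hcon
  have hz1 : ‖z‖ < 1 := by simpa using hz
  have hsub : Metric.closedBall (0 : ℂ) ‖z‖ ⊆ Metric.ball 0 1 := Metric.closedBall_subset_ball hz1
  have hc : ContinuousOn (fun w => ‖1 - V w‖) (Metric.closedBall 0 ‖z‖) :=
    (continuousOn_const.sub (hV.continuousOn.mono hsub)).norm
  have hK : IsCompact (Metric.closedBall (0 : ℂ) ‖z‖ ∩ (fun w => ‖1 - V w‖) ⁻¹' Ici 1) :=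
    (isCompact_closedBall _ _).of_isClosed_subset
      (hc.preimage_isClosed_of_isClosed Metric.isClosed_closedBall isClosed_Ici) inter_subset_left
  obtain ⟨z₀, ⟨hz₀, h1⟩, hmin⟩ := hK.exists_isMinOn ⟨z, by simp, hcon⟩ continuous_norm.continuousOn
  have hz₀' := hsub hz₀
  have hz00 : z₀ ≠ 0 := by
    rintro rfl
    norm_num [h0] at h1
  have hlt : ∀ w ∈ Metric.ball (0 : ℂ) ‖z₀‖, ‖1 - V w‖ ≤ 1 := by
    intro w hw
    by_contra! hw1
    have hw' : ‖w‖ < ‖z₀‖ := by simpa using hw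
    have : ‖z₀‖ ≤ ‖z‖ := by simpa using hz₀
    exact absurd (hmin ⟨by simpa using hw'.le.trans this, hw1.le⟩) (not_le.2 hw')
  have hle : ‖1 - V z₀‖ ≤ 1 := by
    have hcz : ContinuousWithinAt (fun w => ‖1 - V w‖) (Metric.ball 0 ‖z₀‖) z₀ :=
      ((continuousOn_const.sub hV.continuousOn).norm z₀ hz₀').mono
        (Metric.ball_subset_ball (mem_ball_zero_iff.1 hz₀').le)
    refine hcz.closure_le ?_ continuousWithinAt_const hlt
    rw [closure_ball _ (norm_ne_zero_iff.2 hz00)]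
    simp
  have hdV := (hV.differentiableAt (Metric.isOpen_ball.mem_nhds hz₀')).hasDerivAt
  obtain ⟨k, hk, hk'⟩ := jack_boundary (ω := fun w => 1 - V w) hz00
    ((hV.mono (Metric.ball_subset_ball (mem_ball_zero_iff.1 hz₀').le)).const_sub 1) (by simp [h0]) hlt
    (le_antisymm hle h1) (hdV.const_sub 1)
  have h2 := hre z₀ hz₀'
  have hV0 := hne z₀ hz₀'
  have h3 : z₀ * deriv V z₀ / V z₀ = ((k : ℝ) : ℂ) * ((V z₀ - 1) / V z₀) := by
    have : z₀ * deriv V z₀ = k * (V z₀ - 1) := by linear_combination -hk'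
    rw [this, mul_div_assoc]
  -- The circle |1 - V| = 1 passes through 0, and inversion maps it to the line Re (1 / V) = 1/2.
  -- Since k ≥ 1, the logarithmic derivative then violates its bound.
  have h4 : ((V z₀ - 1) / V z₀).re = 1 / 2 := by
    have h5 : ‖1 - V z₀‖ ^ 2 = 1 := by rw [le_antisymm hle h1]; norm_num
    rw [← normSq_eq_norm_sq, normSq_apply] at h5
    have h6 : normSq (V z₀) ≠ 0 := (normSq_pos.2 hV0).ne'
    rw [div_re, ← add_div, div_eq_iff h6, normSq_apply]
    simp only [sub_re, sub_im, one_re, one_im] at h5 ⊢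
    linarith
  rw [h3, re_ofReal_mul, h4] at h2
  linarith

/-! ### Starlikeness of order one half and the Koebe transform -/

/-- With l = q'/q, the condition Re (z l) > -1/2 says |z l| < |1 + z l|. So z l / (1 + z l) maps the
disk into itself and vanishes at 0, and the Schwarz lemma removes the factor z. -/
theorem norm_logDeriv_le {q : ℂ → ℂ} (hq : DifferentiableOn ℂ q (Metric.ball 0 1))
    (hne : ∀ z ∈ Metric.ball (0 : ℂ) 1, q z ≠ 0)
    (hre : ∀ z ∈ Metric.ball (0 : ℂ) 1, -(1 / 2) < (z * (deriv q z / q z)).re) {w : ℂ}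
    (hw : w ∈ Metric.ball (0 : ℂ) 1) :
    ‖deriv q w / q w‖ ≤ ‖1 + w * (deriv q w / q w)‖ := by
  set l : ℂ → ℂ := fun z => deriv q z / q z with hl
  have hld : DifferentiableOn ℂ l (Metric.ball 0 1) := (hq.deriv Metric.isOpen_ball).div hq hne
  have hne' : ∀ z ∈ Metric.ball (0 : ℂ) 1, 1 + z * l z ≠ 0 := fun z hz h => by
    have h1 := hre z hz
    have h2 : z * l z = -1 := by linear_combination h
    simp only [hl] at h2
    rw [h2] at h1
    norm_num at h1
  set σ : ℂ → ℂ := fun z => l z / (1 + z * l z) with hσ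
  have hσd : DifferentiableOn ℂ σ (Metric.ball 0 1) :=
    hld.div ((differentiableOn_id.mul hld).const_add 1) hne'
  have hfd : DifferentiableOn ℂ (fun z => z * σ z) (Metric.ball 0 1) := differentiableOn_id.mul hσd
  have hmaps : MapsTo (fun z => z * σ z) (Metric.ball 0 1)
      (Metric.closedBall ((fun z => z * σ z) 0) 1) := by
    intro z hz
    have h1 := hre z hz
    have h2 : z * σ z = z * l z / (1 + z * l z) := by simp only [hσ]; ring
    simp only [zero_mul, mem_closedBall_zero_iff]
    rw [h2, norm_div]
    refine div_le_one_of_le₀ ?_ (norm_nonneg _)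
    refine le_of_sq_le_sq ?_ (norm_nonneg _)
    rw [← normSq_eq_norm_sq, ← normSq_eq_norm_sq, normSq_apply, normSq_apply]
    simp only [add_re, add_im, one_re, one_im]
    simp only [hl] at *
    nlinarith
  have hσle : ‖σ w‖ ≤ 1 := by
    have h1 := Complex.norm_dslope_le_div_of_mapsTo_ball hfd hmaps hw
    rw [div_one] at h1
    by_cases hw0 : w = 0
    · subst hw0
      have h2 := (hasDerivAt_id (0 : ℂ)).mul
        (hσd.differentiableAt (Metric.isOpen_ball.mem_nhds hw)).hasDerivAt
      have h3 : deriv (fun z => z * σ z) 0 = σ 0 := by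
        have h4 : (fun z => z * σ z) = id * σ := rfl
        rw [h4, h2.deriv]
        simp
      rwa [dslope_same, h3] at h1
    · rw [dslope_of_ne _ hw0, slope_def_field] at h1
      simpa [hw0] using h1
  have h1 := norm_pos_iff.2 (hne' w hw)
  simp only [hσ, norm_div] at hσle
  rw [div_le_one h1] at hσle
  simpa [hl] using hσle

theorem one_add_conj_mul_ne_zero {z ζ : ℂ} (hz : ‖z‖ < 1) (hζ : ‖ζ‖ < 1) :
    1 + (starRingEnd ℂ) z * ζ ≠ 0 := fun h => by
  have h1 : (starRingEnd ℂ) z * ζ = -1 := by linear_combination h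
  have h2 : ‖z‖ * ‖ζ‖ = 1 := by rw [← norm_conj z, ← norm_mul, h1]; simp
  nlinarith [norm_nonneg z, norm_nonneg ζ]

theorem moebius_mem_ball {z ζ : ℂ} (hz : ‖z‖ < 1) (hζ : ‖ζ‖ < 1) :
    (ζ + z) / (1 + (starRingEnd ℂ) z * ζ) ∈ Metric.ball (0 : ℂ) 1 := by
  have hD := one_add_conj_mul_ne_zero hz hζ
  rw [mem_ball_zero_iff, norm_div, div_lt_one (norm_pos_iff.2 hD)]
  refine lt_of_pow_lt_pow_left₀ 2 (norm_nonneg _) ?_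
  have h1 : 0 < (1 - ‖z‖ ^ 2) * (1 - ‖ζ‖ ^ 2) :=
    mul_pos (by nlinarith [norm_nonneg z]) (by nlinarith [norm_nonneg ζ])
  rw [← normSq_eq_norm_sq, ← normSq_eq_norm_sq, normSq_apply, normSq_apply] at h1 ⊢
  simp only [add_re, add_im, one_re, one_im, mul_re, mul_im, conj_re, conj_im]
  nlinarith

/-- The Koebe transform of `q` at `z`, adapted to starlike functions `ζ q(ζ)` of order one half. -/
noncomputable def koebe (q : ℂ → ℂ) (z ζ : ℂ) : ℂ :=
  q ((ζ + z) / (1 + (starRingEnd ℂ) z * ζ)) / (q z * (1 + (starRingEnd ℂ) z * ζ))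

theorem koebe_logDeriv_identity {c D l w z ζ a b : ℂ} (hD : D ≠ 0) (ha : a ≠ 0) (hb : b ≠ 0)
    (hw : w * D = ζ + z) :
    ζ * ((a * c * b - a * D * (l * b * ((1 * D - (ζ + z) * c) / D ^ 2))) / b ^ 2) / (a * D / b) =
      -(ζ * (l - c * (1 + w * l))) / D := by
  obtain rfl : w = (ζ + z) / D := (eq_div_iff hD).2 hw
  field_simp
  ring

section Koebe

variable {q : ℂ → ℂ}

theorem differentiableOn_koebe (hq : DifferentiableOn ℂ q (Metric.ball 0 1))
    (hne : ∀ z ∈ Metric.ball (0 : ℂ) 1, q z ≠ 0) {z : ℂ} (hz : z ∈ Metric.ball (0 : ℂ) 1) :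
    DifferentiableOn ℂ (koebe q z) (Metric.ball 0 1) := by
  have hz1 : ‖z‖ < 1 := by simpa using hz
  have hD : ∀ ζ ∈ Metric.ball (0 : ℂ) 1, 1 + (starRingEnd ℂ) z * ζ ≠ 0 := fun ζ hζ =>
    one_add_conj_mul_ne_zero hz1 (by simpa using hζ)
  refine DifferentiableOn.div (hq.comp (DifferentiableOn.div (by fun_prop) (by fun_prop) hD) ?_)
    (by fun_prop) fun ζ hζ => mul_ne_zero (hne z hz) (hD ζ hζ)
  exact fun ζ hζ => moebius_mem_ball hz1 (by simpa using hζ)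

/-- Starlikeness of order one half passes to the Koebe transform k, and Marx–Strohhäcker for V = 1 /
k gives |1 - 1/k| < 1, which is Re k > 1/2. -/
theorem koebe_re_gt (hq : DifferentiableOn ℂ q (Metric.ball 0 1))
    (hne : ∀ z ∈ Metric.ball (0 : ℂ) 1, q z ≠ 0)
    (hre : ∀ z ∈ Metric.ball (0 : ℂ) 1, -(1 / 2) < (z * (deriv q z / q z)).re)
    {z ζ : ℂ} (hz : z ∈ Metric.ball (0 : ℂ) 1) (hζ : ζ ∈ Metric.ball (0 : ℂ) 1) :
    1 / 2 < (koebe q z ζ).re := by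
  have hz1 : ‖z‖ < 1 := by simpa using hz
  have hD : ∀ ζ ∈ Metric.ball (0 : ℂ) 1, 1 + (starRingEnd ℂ) z * ζ ≠ 0 := fun ζ hζ =>
    one_add_conj_mul_ne_zero hz1 (by simpa using hζ)
  have hmem : ∀ ζ ∈ Metric.ball (0 : ℂ) 1,
      (ζ + z) / (1 + (starRingEnd ℂ) z * ζ) ∈ Metric.ball (0 : ℂ) 1 :=
    fun ζ hζ => moebius_mem_ball hz1 (by simpa using hζ)
  have hk0 : ∀ ζ ∈ Metric.ball (0 : ℂ) 1, koebe q z ζ ≠ 0 := fun ζ hζ =>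
    div_ne_zero (hne _ (hmem ζ hζ)) (mul_ne_zero (hne z hz) (hD ζ hζ))
  have hkd := differentiableOn_koebe hq hne hz
  have hV : ‖1 - (koebe q z ζ)⁻¹‖ < 1 := by
    refine norm_one_sub_lt_one (V := fun ζ => (koebe q z ζ)⁻¹) (hkd.inv hk0) ?_
      (fun ζ hζ => inv_ne_zero (hk0 ζ hζ)) ?_ hζ
    · simp [koebe, hne z hz]
    · intro ζ hζ
      set D := 1 + (starRingEnd ℂ) z * ζ with hDdef
      have hD0 : D ≠ 0 := hD ζ hζ
      set w := (ζ + z) / D with hw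
      have hwm : w ∈ Metric.ball (0 : ℂ) 1 := hmem ζ hζ
      set l := deriv q w / q w with hl
      have hdD : HasDerivAt (fun x => 1 + (starRingEnd ℂ) z * x) ((starRingEnd ℂ) z) ζ := by
        simpa using ((hasDerivAt_id ζ).const_mul ((starRingEnd ℂ) z)).const_add 1
      have hdw := ((hasDerivAt_id ζ).add_const z).div hdD hD0
      have hdq := (hq.differentiableAt (Metric.isOpen_ball.mem_nhds hwm)).hasDerivAt.comp ζ hdw
      have hdV := (hdD.const_mul (q z)).div hdq (hne w hwm)
      have hVeq : (fun ζ => (koebe q z ζ)⁻¹) =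
          (fun x => q z * (1 + (starRingEnd ℂ) z * x)) /
            (q ∘ ((id · + z) / fun x => 1 + (starRingEnd ℂ) z * x)) := by
        funext x
        simp [koebe]
      have hld : ζ * deriv (fun ζ => (koebe q z ζ)⁻¹) ζ / (koebe q z ζ)⁻¹ =
          -(ζ * (l - (starRingEnd ℂ) z * (1 + w * l))) / D := by
        rw [hVeq, hdV.deriv]
        have hqw := hne w hwm
        have hqz := hne z hz
        have hqd : deriv q w = l * q w := by rw [hl, div_mul_cancel₀ _ hqw]
        have hwD : w * D = ζ + z := by rw [hw, div_mul_cancel₀ _ hD0]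
        simp only [koebe, Function.comp_apply, Pi.div_apply, id_eq, ← hDdef, ← hw, hqd]
        rw [inv_div]
        exact koebe_logDeriv_identity hD0 hqz hqw hwD
      rw [hld]
      have hN := norm_logDeriv_le hq hne hre hwm
      rw [← hl] at hN
      have hN0 : 1 + w * l ≠ 0 := fun h => by
        have h1 := hre w hwm
        rw [← hl, show w * l = -1 by linear_combination h] at h1
        norm_num at h1
      set N := 1 + w * l with hNdef
      set P := l - (starRingEnd ℂ) z * N with hP
      set M := N - z * l with hM
      -- The logarithmic derivative becomes -ζP / (M - ζP), whose real part is below 1/2 exactly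
      -- when |ζP| < |M|. This follows from |M|² - |P|² = (1 - |z|²)(|N|² - |l|²) ≥ 0.
      have hMP : M - ζ * P = D := by
        have hwD : w * D = ζ + z := by rw [hw, div_mul_cancel₀ _ hD0]
        rw [hM, hP, hNdef]
        linear_combination (1 + w * l) * hDdef.symm + l * hwD
      have hPM : ‖P‖ ≤ ‖M‖ := by
        refine le_of_sq_le_sq ?_ (norm_nonneg _)
        have h1 : 0 ≤ (1 - ‖z‖ ^ 2) * (‖N‖ ^ 2 - ‖l‖ ^ 2) :=
          mul_nonneg (by nlinarith [norm_nonneg z])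
            (sub_nonneg.2 (pow_le_pow_left₀ (norm_nonneg _) hN 2))
        rw [hP, hM]
        simp only [← normSq_eq_norm_sq, normSq_apply] at h1 ⊢
        simp only [sub_re, sub_im, mul_re, mul_im, conj_re, conj_im]
        nlinarith
      have hM0 : 0 < ‖M‖ := by
        rw [norm_pos_iff, hM, sub_ne_zero]
        intro h
        have h1 : ‖N‖ = ‖z‖ * ‖l‖ := by rw [h, norm_mul]
        have h2 := norm_pos_iff.2 hN0
        nlinarith [norm_nonneg z, norm_nonneg l]
      have hζ1 : ‖ζ‖ < 1 := by simpa using hζ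
      have hxM : ‖ζ * P‖ < ‖M‖ := by
        rw [norm_mul]
        nlinarith [norm_nonneg ζ, norm_nonneg P]
      set x := ζ * P
      have hx2 := pow_lt_pow_left₀ hxM (norm_nonneg _) two_ne_zero
      rw [← hMP] at hD0 ⊢
      have hpos := normSq_pos.2 hD0
      rw [div_re, ← add_div, div_lt_iff₀ hpos, normSq_apply]
      simp only [← normSq_eq_norm_sq, normSq_apply] at hx2
      simp only [sub_re, sub_im, neg_re, neg_im]
      nlinarith
  have hk := hk0 ζ hζ
  have h1 : ‖koebe q z ζ - 1‖ < ‖koebe q z ζ‖ := by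
    have h2 : koebe q z ζ - 1 = koebe q z ζ * (1 - (koebe q z ζ)⁻¹) := by field_simp
    rw [h2, norm_mul]
    exact mul_lt_of_lt_one_right (norm_pos_iff.2 hk) hV
  have h2 := pow_lt_pow_left₀ h1 (norm_nonneg _) two_ne_zero
  simp only [← normSq_eq_norm_sq, normSq_apply, sub_re, sub_im, one_re, one_im] at h2
  linarith

end Koebe

/-- A cube root of the derivative of a function that is close to convex in the sense
`Re (1 + z h'' / h') > -1/2`. -/
theorem exists_cube_root {h : ℂ → ℂ} (hh : DifferentiableOn ℂ h (Metric.ball 0 1))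
    (hne : ∀ z ∈ Metric.ball (0 : ℂ) 1, deriv h z ≠ 0)
    (hre : ∀ z ∈ Metric.ball (0 : ℂ) 1,
      -(1 / 2 : ℝ) < (1 + z * deriv (deriv h) z / deriv h z).re) :
    ∃ q : ℂ → ℂ, DifferentiableOn ℂ q (Metric.ball 0 1) ∧
      (∀ z ∈ Metric.ball (0 : ℂ) 1, q z ≠ 0) ∧
      (∀ z ∈ Metric.ball (0 : ℂ) 1, -(1 / 2) < (z * (deriv q z / q z)).re) ∧
      ∀ z ∈ Metric.ball (0 : ℂ) 1, q z ^ 3 = deriv h z := by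
  have hh1 := hh.deriv Metric.isOpen_ball
  have hh2 := hh1.deriv Metric.isOpen_ball
  obtain ⟨P, hP0, hP⟩ := (hh2.div hh1 hne).isExactOn_ball.with_val_at 0 (Complex.log (deriv h 0))
  have h0mem : (0 : ℂ) ∈ Metric.ball (0 : ℂ) 1 := by simp
  have hconst : ∀ z ∈ Metric.ball (0 : ℂ) 1, deriv h z * exp (-P z) = 1 := by
    intro z hz
    have hd : ∀ w ∈ Metric.ball (0 : ℂ) 1,
        HasDerivAt (fun w => deriv h w * exp (-P w)) 0 w := fun w hw => by
      have h1 := (hh1.differentiableAt (Metric.isOpen_ball.mem_nhds hw)).hasDerivAt.mul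
        (hP w hw).neg.cexp
      refine h1.congr_deriv ?_
      have := hne w hw
      simp only [Pi.div_apply]
      field_simp
      ring
    have := (convex_ball (0 : ℂ) 1).is_const_of_fderivWithin_eq_zero (𝕜 := ℂ)
      (fun w hw => (hd w hw).differentiableAt.differentiableWithinAt) (fun w hw => by
        rw [fderivWithin_of_isOpen Metric.isOpen_ball hw]
        ext
        simp [(hd w hw).deriv]) hz h0mem
    rw [this, hP0, exp_neg, exp_log (hne 0 h0mem), mul_inv_cancel₀ (hne 0 h0mem)]
  have hq : ∀ z ∈ Metric.ball (0 : ℂ) 1, HasDerivAt (fun z => exp (P z / 3))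
      (exp (P z / 3) * ((deriv (deriv h) z / deriv h z) / 3)) z := fun z hz =>
    ((hP z hz).div_const 3).cexp
  refine ⟨fun z => exp (P z / 3), fun z hz => (hq z hz).differentiableAt.differentiableWithinAt,
    fun z _ => exp_ne_zero _, fun z hz => ?_, fun z hz => ?_⟩
  · rw [(hq z hz).deriv, mul_div_cancel_left₀ _ (exp_ne_zero _)]
    have h1 := hre z hz
    have h2 : z * (deriv (deriv h) z / deriv h z / 3) =
        ((1 / 3 : ℝ) : ℂ) * (z * deriv (deriv h) z / deriv h z) := by push_cast; ring
    rw [h2, re_ofReal_mul]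
    rw [add_re, one_re] at h1
    linarith
  · rw [← exp_nat_mul, show ((3 : ℕ) : ℂ) * (P z / 3) = P z by push_cast; ring]
    have := hconst z hz
    rw [exp_neg] at this
    exact (eq_of_div_eq_one this).symm

/-! ### Averaging over kernels: Herglotz representation and Feynman parameters -/

/-- Positivity of `Re ∫ φ(t) K(t, s) dt` for each `s` passes to the average of `K` over `s`. -/
theorem re_integral_pos_of_kernel {φ : ℝ → ℂ} {K : ℝ → ℝ → ℂ} {a b : ℝ} (hab : a < b)
    (hφ : ContinuousOn φ (Icc 0 1))
    (hK : ContinuousOn (Function.uncurry K) (Icc 0 1 ×ˢ Icc a b))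
    (hpos : ∀ s ∈ Ioo a b, 0 < (∫ t in (0 : ℝ)..1, φ t * K t s).re) :
    0 < (∫ t in (0 : ℝ)..1, φ t * ∫ s in a..b, K t s).re := by
  have hc : ContinuousOn (Function.uncurry fun t s => φ t * K t s) (Icc 0 1 ×ˢ Icc a b) :=
    (hφ.comp continuousOn_fst fun p hp => hp.1).mul hK
  have hi : IntegrableOn (Function.uncurry fun t s => φ t * K t s) (Ioc 0 1 ×ˢ Ioc a b) :=
    (hc.integrableOn_compact (isCompact_Icc.prod isCompact_Icc)).mono_set
      (prod_mono Ioc_subset_Icc_self Ioc_subset_Icc_self)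
  have hi' : Integrable (Function.uncurry fun t s => φ t * K t s)
      ((volume.restrict (Ioc 0 1)).prod (volume.restrict (Ioc a b))) := by
    rwa [Measure.prod_restrict, ← Measure.volume_eq_prod]
  have hs : IntervalIntegrable (fun s => ∫ t in (0 : ℝ)..1, φ t * K t s) volume a b := by
    rw [intervalIntegrable_iff_integrableOn_Ioc_of_le hab.le]
    simp only [intervalIntegral.integral_of_le zero_le_one]
    exact hi'.integral_prod_right
  have e1 : ∫ t in (0 : ℝ)..1, φ t * ∫ s in a..b, K t s =
      ∫ s in a..b, ∫ t in (0 : ℝ)..1, φ t * K t s := by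
    rw [← intervalIntegral_intervalIntegral_swap
      (by rwa [uIoc_of_le zero_le_one, uIoc_of_le hab.le])]
    simp only [intervalIntegral.integral_const_mul]
  rw [e1]
  have e2 : (∫ s in a..b, ∫ t in (0 : ℝ)..1, φ t * K t s).re =
      ∫ s in a..b, (∫ t in (0 : ℝ)..1, φ t * K t s).re :=
    (reCLM.intervalIntegral_comp_comm hs).symm
  rw [e2]
  refine intervalIntegral.intervalIntegral_pos_of_pos_on ?_ hpos hab
  exact ⟨hs.1.re, hs.2.re⟩

theorem one_sub_mul_ne_zero {w : ℂ} (hw : ‖w‖ < 1) {t : ℝ} (ht : t ∈ Icc (0 : ℝ) 1) :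
    1 - t * w ≠ 0 := fun h => by
  have h1 : (t : ℂ) * w = 1 := by linear_combination -h
  have h2 : ‖(t : ℂ) * w‖ = 1 := by rw [h1, norm_one]
  rw [norm_mul, norm_real, Real.norm_of_nonneg ht.1] at h2
  nlinarith [ht.2, norm_nonneg w, ht.1]

/-- The Herglotz representation of a function with `Re Q > 1/2` on a smaller circle. -/
theorem herglotz_representation {Q : ℂ → ℂ} (hQ : DifferentiableOn ℂ Q (Metric.ball 0 1))
    (Q0 : Q 0 = 1) {ρ : ℝ} (hρ0 : 0 < ρ) (hρ1 : ρ < 1) {ζ : ℂ} (hζ : ‖ζ‖ < ρ) :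
    Q ζ = Real.circleAverage (fun x => ((2 * (Q x).re - 1 : ℝ) : ℂ) * (x / (x - ζ))) 0 ρ := by
  have habs : |ρ| = ρ := abs_of_pos hρ0
  have hsub : Metric.closedBall (0 : ℂ) ρ ⊆ Metric.ball 0 1 := Metric.closedBall_subset_ball hρ1
  have hQd : DiffContOnCl ℂ Q (Metric.ball 0 |ρ|) := by
    rw [habs]
    refine DifferentiableOn.diffContOnCl ?_
    rw [closure_ball _ hρ0.ne']
    exact hQ.mono hsub
  have hζm : ζ ∈ Metric.ball (0 : ℂ) |ρ| := by simpa [habs] using hζ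
  have hden : ∀ x ∈ Metric.closedBall (0 : ℂ) ρ, (ρ : ℂ) ^ 2 - (starRingEnd ℂ) ζ * x ≠ 0 := by
    intro x hx h
    have h1 : ‖(ρ : ℂ) ^ 2‖ = ‖(starRingEnd ℂ) ζ * x‖ := by rw [sub_eq_zero.1 h]
    rw [norm_pow, norm_real, Real.norm_of_nonneg hρ0.le, norm_mul, norm_conj] at h1
    have hx' : ‖x‖ ≤ ρ := by simpa using hx
    nlinarith [norm_nonneg ζ, norm_nonneg x]
  -- `G` is analytic with G(0) = 0, so conj G has average 0 over the circle, where it equals (conj Q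
  -- - 1) x / (x - ζ). Adding it to Cauchy's formula for Q produces the real weight 2 Re Q - 1.
  set G : ℂ → ℂ := fun x => (Q x - 1) * ((ρ : ℂ) ^ 2 / ((ρ : ℂ) ^ 2 - (starRingEnd ℂ) ζ * x)) with hGdef
  have hGd : DifferentiableOn ℂ G (Metric.closedBall 0 ρ) := ((hQ.mono hsub).sub_const 1).mul
    (DifferentiableOn.div (by fun_prop) (by fun_prop) hden)
  have hG : DiffContOnCl ℂ G (Metric.ball 0 |ρ|) := by
    rw [habs]
    refine DifferentiableOn.diffContOnCl ?_
    rwa [closure_ball _ hρ0.ne']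
  have hGi : CircleIntegrable G 0 ρ :=
    (hGd.continuousOn.mono Metric.sphere_subset_closedBall).circleIntegrable hρ0.le
  have hζx : ∀ x ∈ Metric.sphere (0 : ℂ) ρ, x - ζ ≠ 0 := fun x hx h => by
    rw [sub_eq_zero] at h
    rw [mem_sphere_zero_iff_norm, h] at hx
    exact hζ.ne hx
  have hKi : CircleIntegrable (fun x => ((x - 0) / (x - ζ)) • Q x) 0 ρ := by
    refine ContinuousOn.circleIntegrable hρ0.le (ContinuousOn.fun_smul ?_ ?_)
    · exact ContinuousOn.div (by fun_prop) (by fun_prop) hζx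
    · exact hQ.continuousOn.mono (Metric.sphere_subset_closedBall.trans hsub)
  have h1 : Real.circleAverage (conjCLE.toContinuousLinearMap ∘ G) 0 ρ = 0 := by
    rw [ContinuousLinearMap.circleAverage_comp_comm _ hGi, hG.circleAverage]
    simp [hGdef, Q0]
  have hci : CircleIntegrable (conjCLE.toContinuousLinearMap ∘ G) 0 ρ := by
    refine ContinuousOn.circleIntegrable hρ0.le ?_
    exact conjCLE.continuous.comp_continuousOn
      (hGd.continuousOn.mono Metric.sphere_subset_closedBall)
  have h2 := hQd.circleAverage_smul_div hζm
  have h3 := Real.circleAverage_add hKi hci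
  rw [h1, h2, add_zero] at h3
  rw [← h3]
  refine Real.circleAverage_congr_sphere fun x hx => ?_
  rw [habs] at hx
  have hx0 : x ≠ 0 := by
    rintro rfl
    simp [hρ0.ne] at hx
  have hxn : (ρ : ℂ) ^ 2 = (starRingEnd ℂ) x * x := by
    rw [← normSq_eq_conj_mul_self, normSq_eq_norm_sq, mem_sphere_zero_iff_norm.1 hx]
    push_cast
    rfl
  have hcx : (starRingEnd ℂ) x - (starRingEnd ℂ) ζ ≠ 0 := by
    rw [← map_sub]
    exact (map_ne_zero _).2 (hζx x hx)
  have hker : (ρ : ℂ) ^ 2 / ((ρ : ℂ) ^ 2 - (starRingEnd ℂ) ζ * x) =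
      (starRingEnd ℂ) (x / (x - ζ)) := by
    rw [hxn, ← sub_mul, mul_div_mul_right _ _ hx0, map_div₀, map_sub]
  have hre : ((2 * (Q x).re - 1 : ℝ) : ℂ) = Q x + (starRingEnd ℂ) (Q x) - 1 := by
    rw [add_conj]
    push_cast
    ring
  simp only [Pi.add_apply, Function.comp_apply, smul_eq_mul, sub_zero, hGdef, hker, hre]
  simp
  ring

/-- Positivity against the kernels `1 / (1 - t w)` gives positivity against `Q(t z)`. -/
theorem re_integral_mul_pos_of_inv {Q : ℂ → ℂ} {ψ : ℝ → ℂ}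
    (hQ : DifferentiableOn ℂ Q (Metric.ball 0 1)) (Q0 : Q 0 = 1)
    (hre : ∀ z ∈ Metric.ball (0 : ℂ) 1, 1 / 2 < (Q z).re) (hψ : ContinuousOn ψ (Icc 0 1))
    {z : ℂ} {r : ℝ} (hr1 : r < 1) (hzr : ‖z‖ < r)
    (hpos : ∀ w : ℂ, ‖w‖ ≤ r → 0 < (∫ t in (0 : ℝ)..1, ψ t * (1 - t * w)⁻¹).re) :
    0 < (∫ t in (0 : ℝ)..1, ψ t * Q (t * z)).re := by
  have hr0 : 0 < r := (norm_nonneg z).trans_lt hzr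
  -- the radius of the circle is chosen such that `‖z‖ / ρ ≤ r`
  obtain ⟨ρ, hρ1, hρ2⟩ := exists_between (max_lt ((div_lt_one hr0).2 hzr) hr1)
  have hρ0 : 0 < ρ := hr0.trans ((le_max_right _ _).trans_lt hρ1)
  have hzρ : ‖z‖ < r * ρ := by
    rw [mul_comm, ← div_lt_iff₀ hr0]
    exact (le_max_left _ _).trans_lt hρ1
  have hcm : ∀ θ, circleMap 0 ρ θ ∈ Metric.ball (0 : ℂ) 1 := fun θ => by
    simpa [abs_of_pos hρ0] using hρ2
  have hcm0 : ∀ θ, circleMap 0 ρ θ ≠ 0 := fun θ => circleMap_ne_center hρ0.ne'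
  have hw : ∀ θ, ‖z / circleMap 0 ρ θ‖ ≤ r := fun θ => by
    rw [norm_div, norm_circleMap_zero, abs_of_pos hρ0, div_le_iff₀ hρ0]
    exact hzρ.le
  have hK : ContinuousOn (Function.uncurry fun (t θ : ℝ) =>
      ((2 * (Q (circleMap 0 ρ θ)).re - 1 : ℝ) : ℂ) * (1 - t * (z / circleMap 0 ρ θ))⁻¹)
      (Icc 0 1 ×ˢ Icc 0 (2 * Real.pi)) := by
    have hc : Continuous fun p : ℝ × ℝ => circleMap 0 ρ p.2 :=
      (continuous_circleMap 0 ρ).comp continuous_snd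
    refine ContinuousOn.mul ?_ (ContinuousOn.inv₀ ?_ ?_)
    · have h1 : Continuous fun p : ℝ × ℝ => Q (circleMap 0 ρ p.2) :=
        hQ.continuousOn.comp_continuous hc fun p => hcm _
      exact (continuous_ofReal.comp
        ((continuous_const.mul (continuous_re.comp h1)).sub continuous_const)).continuousOn
    · exact (continuous_const.sub ((continuous_ofReal.comp continuous_fst).mul
        (continuous_const.div hc fun p => hcm0 _))).continuousOn
    · exact fun p hp => one_sub_mul_ne_zero ((hw _).trans_lt hr1) hp.1
  have hmain := re_integral_pos_of_kernel Real.two_pi_pos hψ hK fun θ _ => by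
    have h1 : ∫ t in (0 : ℝ)..1, ψ t * (((2 * (Q (circleMap 0 ρ θ)).re - 1 : ℝ) : ℂ) *
        (1 - t * (z / circleMap 0 ρ θ))⁻¹) = ((2 * (Q (circleMap 0 ρ θ)).re - 1 : ℝ) : ℂ) *
        ∫ t in (0 : ℝ)..1, ψ t * (1 - t * (z / circleMap 0 ρ θ))⁻¹ := by
      rw [← intervalIntegral.integral_const_mul]
      congr 1
      funext t
      ring
    rw [h1, re_ofReal_mul]
    exact mul_pos (by linarith [hre _ (hcm θ)]) (hpos _ (hw θ))
  have h2 : ∀ t ∈ Icc (0 : ℝ) 1, ∫ θ in (0 : ℝ)..2 * Real.pi,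
      ((2 * (Q (circleMap 0 ρ θ)).re - 1 : ℝ) : ℂ) * (1 - t * (z / circleMap 0 ρ θ))⁻¹ =
      ((2 * Real.pi : ℝ) : ℂ) * Q (t * z) := by
    intro t ht
    have htz : ‖(t : ℂ) * z‖ < ρ := by
      rw [norm_mul, norm_real, Real.norm_of_nonneg ht.1]
      have : r * ρ ≤ ρ := by nlinarith
      nlinarith [norm_nonneg z, ht.2]
    rw [herglotz_representation hQ Q0 hρ0 hρ2 htz, Real.circleAverage_def, real_smul, ← mul_assoc,
      ← ofReal_mul, mul_inv_cancel₀ Real.two_pi_pos.ne', ofReal_one, one_mul]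
    congr 1
    funext θ
    have h3 := hcm0 θ
    rw [← mul_div_assoc, one_sub_div h3, inv_div]
  have h3 : ∫ t in (0 : ℝ)..1, ψ t * ∫ θ in (0 : ℝ)..2 * Real.pi,
      ((2 * (Q (circleMap 0 ρ θ)).re - 1 : ℝ) : ℂ) * (1 - t * (z / circleMap 0 ρ θ))⁻¹ =
      ((2 * Real.pi : ℝ) : ℂ) * ∫ t in (0 : ℝ)..1, ψ t * Q (t * z) := by
    rw [← intervalIntegral.integral_const_mul]
    refine intervalIntegral.integral_congr fun t ht => ?_
    rw [uIcc_of_le zero_le_one] at ht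
    simp only [h2 t ht]
    ring
  rw [h3, re_ofReal_mul] at hmain
  exact pos_of_mul_pos_right hmain Real.two_pi_pos.le

theorem convex_comb_norm_le {w₁ w₂ : ℂ} {r : ℝ} (h₁ : ‖w₁‖ ≤ r) (h₂ : ‖w₂‖ ≤ r) {p : ℝ}
    (hp : p ∈ Icc (0 : ℝ) 1) : ‖p * w₁ + (1 - p) * w₂‖ ≤ r := by
  have h := convex_closedBall (0 : ℂ) r (mem_closedBall_zero_iff.2 h₁)
    (mem_closedBall_zero_iff.2 h₂) hp.1 (sub_nonneg.2 hp.2) (add_sub_cancel p 1)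
  simpa using h

/-- Feynman parametrization. For factors 1 - t w, affine in w, the convex combination is again of
this form, with w in the same disk; this and `feynman_three` reduce products of different kernels to
powers of one. -/
theorem feynman_two {B C : ℂ} (hC : C ≠ 0) (hne : ∀ p ∈ Icc (0 : ℝ) 1, p * B + (1 - p) * C ≠ 0) :
    ∫ p in (0 : ℝ)..1, ((p * B + (1 - p) * C) ^ 2)⁻¹ = (B * C)⁻¹ := by
  have hB : B ≠ 0 := by simpa using hne 1 (by simp)
  have hd : ∀ p ∈ uIcc (0 : ℝ) 1, HasDerivAt
      (fun p : ℝ => (p : ℂ) / (C * (p * B + (1 - p) * C))) (((p * B + (1 - p) * C) ^ 2)⁻¹) p := by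
    intro p hp
    rw [uIcc_of_le zero_le_one] at hp
    have h0 := hne p hp
    have h1 : HasDerivAt (fun p : ℂ => p) 1 (p : ℂ) := hasDerivAt_id _
    have h2 := (h1.div (((h1.mul_const B).add ((h1.const_sub 1).mul_const C)).const_mul C)
      (mul_ne_zero hC h0)).comp_ofReal
    refine h2.congr_deriv ?_
    simp only [Pi.add_apply]
    field_simp
    ring
  rw [intervalIntegral.integral_eq_sub_of_hasDerivAt hd]
  · simp
    ring
  · refine ContinuousOn.intervalIntegrable (ContinuousOn.inv₀ (by fun_prop) fun p hp => ?_)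
    rw [uIcc_of_le zero_le_one] at hp
    exact pow_ne_zero 2 (hne p hp)

theorem feynman_three {A B : ℂ} (hne : ∀ s ∈ Icc (0 : ℝ) 1, s * A + (1 - s) * B ≠ 0) :
    ∫ s in (0 : ℝ)..1, 2 * (1 - s : ℂ) * ((s * A + (1 - s) * B) ^ 3)⁻¹ = (A * B ^ 2)⁻¹ := by
  have hA : A ≠ 0 := by simpa using hne 1 (by simp)
  have hB : B ≠ 0 := by simpa using hne 0 (by simp)
  have hd : ∀ s ∈ uIcc (0 : ℝ) 1, HasDerivAt
      (fun s : ℝ => -((1 - s : ℂ) ^ 2 / (A * (s * A + (1 - s) * B) ^ 2)))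
      (2 * (1 - s : ℂ) * ((s * A + (1 - s) * B) ^ 3)⁻¹) s := by
    intro s hs
    rw [uIcc_of_le zero_le_one] at hs
    have h0 := hne s hs
    have h1 : HasDerivAt (fun s : ℂ => s) 1 (s : ℂ) := hasDerivAt_id _
    have h2 := (((h1.const_sub 1).pow 2).div
      ((((h1.mul_const A).add ((h1.const_sub 1).mul_const B)).pow 2).const_mul A)
      (mul_ne_zero hA (pow_ne_zero 2 h0))).neg.comp_ofReal
    refine h2.congr_deriv ?_
    simp only [Pi.add_apply, Pi.pow_apply]
    field_simp
    ring
  rw [intervalIntegral.integral_eq_sub_of_hasDerivAt hd]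
  · simp
  · refine ContinuousOn.intervalIntegrable (ContinuousOn.mul (by fun_prop)
      (ContinuousOn.inv₀ (by fun_prop) fun s hs => ?_))
    rw [uIcc_of_le zero_le_one] at hs
    exact pow_ne_zero 3 (hne s hs)

theorem integral_closed_form {u w : ℂ} (hw : ‖w‖ < 1) :
    ∫ t in (0 : ℝ)..1, (1 - t * u) * ((1 - t * w) ^ 3)⁻¹ = (1 - (u + w) / 2) / (1 - w) ^ 2 := by
  have hd : ∀ t ∈ uIcc (0 : ℝ) 1, HasDerivAt
      (fun t : ℝ => (t - t ^ 2 * ((u + w) / 2) : ℂ) / (1 - t * w) ^ 2)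
      ((1 - t * u) * ((1 - t * w) ^ 3)⁻¹) t := by
    intro t ht
    rw [uIcc_of_le zero_le_one] at ht
    have h0 := one_sub_mul_ne_zero hw ht
    have h1 : HasDerivAt (fun t : ℂ => t) 1 (t : ℂ) := hasDerivAt_id _
    have h2 := ((h1.sub ((h1.pow 2).mul_const ((u + w) / 2))).div
      (((h1.mul_const w).const_sub 1).pow 2) (pow_ne_zero 2 h0)).comp_ofReal
    refine h2.congr_deriv ?_
    simp only [Pi.sub_apply, Pi.pow_apply]
    rw [← div_eq_mul_inv, div_eq_div_iff (pow_ne_zero 2 (pow_ne_zero 2 h0)) (pow_ne_zero 3 h0)]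
    push_cast
    ring
  rw [intervalIntegral.integral_eq_sub_of_hasDerivAt hd]
  · simp
  · refine ContinuousOn.intervalIntegrable (ContinuousOn.mul (by fun_prop)
      (ContinuousOn.inv₀ (by fun_prop) fun t ht => ?_))
    rw [uIcc_of_le zero_le_one] at ht
    exact pow_ne_zero 3 (one_sub_mul_ne_zero hw ht)

/-- With v = 1 - w the sign is that of Re ((1 + v - u) conj(v)²). The worst u costs r |v|² and the
worst w lies on |w| = r; what remains is a quadratic in p = Re v. -/
theorem re_extremal_pos {u w : ℂ} {r : ℝ} (hr1 : r < 1) (hr : r ^ 2 + 10 * r - 7 < 0)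
    (hu : ‖u‖ ≤ r) (hw : ‖w‖ ≤ r) : 0 < ((1 - (u + w) / 2) / (1 - w) ^ 2).re := by
  have hr0 : 0 ≤ r := (norm_nonneg u).trans hu
  set v := 1 - w with hv
  have hv0 : v ≠ 0 := by
    have := one_sub_mul_ne_zero (hw.trans_lt hr1) (t := 1) (by simp)
    simpa [hv] using this
  have h1 : (1 - (u + w) / 2) / v ^ 2 =
      ((1 / (2 * normSq v ^ 2) : ℝ) : ℂ) * ((1 + v - u) * (starRingEnd ℂ) v ^ 2) := by
    have hcv : (starRingEnd ℂ) v ≠ 0 := (map_ne_zero _).2 hv0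
    push_cast
    rw [normSq_eq_conj_mul_self]
    have h2 : 1 - (u + w) / 2 = (1 + v - u) / 2 := by rw [hv]; ring
    rw [h2]
    field_simp
  rw [h1, re_ofReal_mul]
  refine mul_pos (by have := normSq_pos.2 hv0; positivity) ?_
  have h2 : (u * (starRingEnd ℂ) v ^ 2).re ≤ r * normSq v := by
    refine (re_le_norm _).trans ?_
    rw [norm_mul, norm_pow, norm_conj, normSq_eq_norm_sq]
    exact mul_le_mul_of_nonneg_right hu (by positivity)
  have h3 : ((1 + v - u) * (starRingEnd ℂ) v ^ 2).re =
      ((1 + v) * (starRingEnd ℂ) v ^ 2).re - (u * (starRingEnd ℂ) v ^ 2).re := by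
    rw [sub_mul, sub_re]
  have h4 : ((1 + v) * (starRingEnd ℂ) v ^ 2).re =
      v.re ^ 2 - v.im ^ 2 + (v.re ^ 2 + v.im ^ 2) * v.re := by
    simp only [pow_two, mul_re, mul_im, add_re, add_im, one_re, one_im, conj_re, conj_im]
    ring
  have h5 : (1 - v.re) ^ 2 + v.im ^ 2 ≤ r ^ 2 := by
    have := pow_le_pow_left₀ (norm_nonneg _) hw 2
    rw [← normSq_eq_norm_sq, normSq_apply] at this
    simp only [hv, sub_re, sub_im, one_re, one_im]
    nlinarith
  rw [h3, h4]
  rw [normSq_apply] at h2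
  set p := v.re
  set y := v.im
  have h6 : 0 ≤ 1 - p + r := by
    linarith [(abs_le_of_sq_le_sq' (by nlinarith [sq_nonneg y] : (1 - p) ^ 2 ≤ r ^ 2) hr0).1]
  have h7 : 0 ≤ (r ^ 2 - ((1 - p) ^ 2 + y ^ 2)) * (1 - p + r) := mul_nonneg (by linarith) h6
  -- The quadratic arises by giving y² its largest value r² - (1 - p)². Its discriminant is (r + 1)²
  -- (r² + 10 r - 7), the source of 4 √2 - 5.
  have h8 : 0 < 16 * (4 * p ^ 2 - (r + 1) * (3 - r) * p + (1 - r) * (1 + r) ^ 2) := by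
    have h9 : 0 < (r + 1) ^ 2 * -(r ^ 2 + 10 * r - 7) := by
      have : 0 < -(r ^ 2 + 10 * r - 7) := by linarith
      positivity
    nlinarith [sq_nonneg (8 * p - (r + 1) * (3 - r))]
  nlinarith

/-- The key positivity: `Re ∫₀¹ (1 - t u) Q(t z)³ dt > 0` when `|z|` and `|u|` lie below the radius
of starlikeness of close-to-convex functions. -/
theorem re_integral_cube_pos {Q : ℂ → ℂ}
    (hQ : DifferentiableOn ℂ Q (Metric.ball 0 1)) (Q0 : Q 0 = 1)
    (hre : ∀ z ∈ Metric.ball (0 : ℂ) 1, 1 / 2 < (Q z).re) {z u : ℂ} {r : ℝ} (hr1 : r < 1)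
    (hr : r ^ 2 + 10 * r - 7 < 0) (hzr : ‖z‖ < r) (hu : ‖u‖ ≤ r) :
    0 < (∫ t in (0 : ℝ)..1, (1 - t * u) * Q (t * z) ^ 3).re := by
  have hQc : ContinuousOn (fun t : ℝ => Q (t * z)) (Icc 0 1) := by
    refine hQ.continuousOn.comp (by fun_prop) fun t ht => ?_
    rw [mem_ball_zero_iff, norm_mul, norm_real, Real.norm_of_nonneg ht.1]
    nlinarith [norm_nonneg z, ht.2]
  have hkc : ∀ {w : ℂ}, ‖w‖ ≤ r → ContinuousOn (fun t : ℝ => (1 - t * w)⁻¹) (Icc 0 1) :=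
    fun hw => ContinuousOn.inv₀ (by fun_prop) fun t ht => one_sub_mul_ne_zero (hw.trans_lt hr1) ht
  have hφ : ContinuousOn (fun t : ℝ => 1 - t * u) (Icc 0 1) := by fun_prop
  have hcomb : ∀ (t p : ℝ) (a b : ℂ),
      p * (1 - t * a) + (1 - p) * (1 - t * b) = 1 - t * (p * a + (1 - p) * b) := by
    intros; ring
  -- three equal kernels
  have s1 : ∀ w : ℂ, ‖w‖ ≤ r → 0 < (∫ t in (0 : ℝ)..1, (1 - t * u) * ((1 - t * w) ^ 3)⁻¹).re :=
    fun w hw => by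
      rw [integral_closed_form (hw.trans_lt hr1)]
      exact re_extremal_pos hr1 hr hu hw
  -- two equal kernels
  have s2 : ∀ w₁ w₂ : ℂ, ‖w₁‖ ≤ r → ‖w₂‖ ≤ r → 0 < (∫ t in (0 : ℝ)..1,
      (1 - t * u) * ((1 - t * w₁) * (1 - t * w₂) ^ 2)⁻¹).re := by
    intro w₁ w₂ hw₁ hw₂
    have h := re_integral_pos_of_kernel (K := fun t s : ℝ => 2 * (1 - s : ℂ) *
      ((s * (1 - t * w₁) + (1 - s) * (1 - t * w₂)) ^ 3)⁻¹) one_pos hφ ?_ ?_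
    · convert h using 2
      refine intervalIntegral.integral_congr fun t ht => ?_
      rw [uIcc_of_le zero_le_one] at ht
      rw [feynman_three fun s hs => ?_]
      rw [hcomb]
      exact one_sub_mul_ne_zero ((convex_comb_norm_le hw₁ hw₂ hs).trans_lt hr1) ht
    · refine ContinuousOn.mul (by fun_prop) (ContinuousOn.inv₀ (by fun_prop) fun p hp => ?_)
      rw [hcomb]
      exact pow_ne_zero 3
        (one_sub_mul_ne_zero ((convex_comb_norm_le hw₁ hw₂ hp.2).trans_lt hr1) hp.1)
    · intro s hs
      have h1 : ∫ t in (0 : ℝ)..1, (1 - t * u) * (2 * (1 - s : ℂ) *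
          ((s * (1 - t * w₁) + (1 - s) * (1 - t * w₂)) ^ 3)⁻¹) =
          ((2 * (1 - s) : ℝ) : ℂ) * ∫ t in (0 : ℝ)..1,
            (1 - t * u) * ((1 - t * (s * w₁ + (1 - s) * w₂)) ^ 3)⁻¹ := by
        rw [← intervalIntegral.integral_const_mul]
        congr 1
        funext t
        rw [hcomb]
        push_cast
        ring
      rw [h1, re_ofReal_mul]
      exact mul_pos (by linarith [hs.2]) (s1 _ (convex_comb_norm_le hw₁ hw₂ ⟨hs.1.le, hs.2.le⟩))
  -- three different kernels
  have s3 : ∀ w₁ w₂ w₃ : ℂ, ‖w₁‖ ≤ r → ‖w₂‖ ≤ r → ‖w₃‖ ≤ r → 0 < (∫ t in (0 : ℝ)..1,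
      (1 - t * u) * (1 - t * w₁)⁻¹ * (1 - t * w₂)⁻¹ * (1 - t * w₃)⁻¹).re := by
    intro w₁ w₂ w₃ hw₁ hw₂ hw₃
    have h := re_integral_pos_of_kernel (φ := fun t : ℝ => (1 - t * u) * (1 - t * w₁)⁻¹)
      (K := fun t p : ℝ => ((p * (1 - t * w₂) + (1 - p) * (1 - t * w₃)) ^ 2)⁻¹) one_pos
      (hφ.mul (hkc hw₁)) ?_ ?_
    · convert h using 2
      refine intervalIntegral.integral_congr fun t ht => ?_
      rw [uIcc_of_le zero_le_one] at ht
      rw [feynman_two (one_sub_mul_ne_zero (hw₃.trans_lt hr1) ht) fun s hs => ?_, mul_inv]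
      · ring
      rw [hcomb]
      exact one_sub_mul_ne_zero ((convex_comb_norm_le hw₂ hw₃ hs).trans_lt hr1) ht
    · refine ContinuousOn.inv₀ (by fun_prop) fun p hp => ?_
      rw [hcomb]
      exact pow_ne_zero 2
        (one_sub_mul_ne_zero ((convex_comb_norm_le hw₂ hw₃ hp.2).trans_lt hr1) hp.1)
    · intro s hs
      convert s2 w₁ _ hw₁ (convex_comb_norm_le hw₂ hw₃ ⟨hs.1.le, hs.2.le⟩) using 2
      congr 1
      funext t
      rw [hcomb, mul_inv]
      ring
  -- The three kernels are now exchanged for factors Q one at a time.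
  have s4 : ∀ w₁ w₂ : ℂ, ‖w₁‖ ≤ r → ‖w₂‖ ≤ r → 0 < (∫ t in (0 : ℝ)..1,
      (1 - t * u) * (1 - t * w₁)⁻¹ * (1 - t * w₂)⁻¹ * Q (t * z)).re := fun w₁ w₂ hw₁ hw₂ =>
    re_integral_mul_pos_of_inv hQ Q0 hre ((hφ.mul (hkc hw₁)).mul (hkc hw₂)) hr1 hzr
      fun w hw => s3 w₁ w₂ w hw₁ hw₂ hw
  have s5 : ∀ w₁ : ℂ, ‖w₁‖ ≤ r → 0 < (∫ t in (0 : ℝ)..1,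
      (1 - t * u) * (1 - t * w₁)⁻¹ * Q (t * z) * Q (t * z)).re := fun w₁ hw₁ =>
    re_integral_mul_pos_of_inv hQ Q0 hre ((hφ.mul (hkc hw₁)).mul hQc) hr1 hzr fun w hw => by
      convert s4 w₁ w hw₁ hw using 3
      funext t
      simp only [Pi.mul_apply]
      ring
  have s6 : 0 < (∫ t in (0 : ℝ)..1, (1 - t * u) * Q (t * z) * Q (t * z) * Q (t * z)).re :=
    re_integral_mul_pos_of_inv hQ Q0 hre ((hφ.mul hQc).mul hQc) hr1 hzr fun w hw => by
      convert s5 w hw using 3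
      funext t
      simp only [Pi.mul_apply]
      ring
  convert s6 using 3
  funext t
  ring

/-! ### Integration along a radius and the lower bound -/

/-- The chain rule for F along w = (1 - t) z / D. The powers of D cancel: 1 + λ w contributes D⁻¹,
the derivative of w contributes D⁻², and the cube of q(w) = q(z) D Q contributes D³. -/
theorem radial_koebe_identity {a b c l t z D : ℂ} (hDdef : D = 1 - t * (c * z)) (hD : D ≠ 0)
    (hl : 1 + l * z ≠ 0) (hb : b ≠ 0) :
    (1 + l * ((1 - t) * z / D)) * a ^ 3 * ((-1 * z * D - (1 - t) * z * -(1 * (c * z))) / D ^ 2) =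
      -(z * (1 - c * z) * ((1 + l * z) * b ^ 3)) *
        ((1 - t * ((c + l) / (1 + l * z) * z)) * (a / (b * D)) ^ 3) := by
  field_simp
  rw [hDdef]
  ring

/-- If `h` is in the class `Re (1 + z h'' / h') > -1/2` and `g' = z h'`, the functions
`h + l g` with `|l| ≤ 1` (which are close-to-convex) satisfy `Re (z f' / f) > 0` for
`|z| < 4 √2 - 5`. -/
theorem re_analytic_pos {h g : ℂ → ℂ} (hh : DifferentiableOn ℂ h (Metric.ball 0 1))
    (hg : DifferentiableOn ℂ g (Metric.ball 0 1)) (h0 : h 0 = 0) (g0 : g 0 = 0)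
    (hgh : ∀ z ∈ Metric.ball (0 : ℂ) 1, deriv g z = z * deriv h z)
    (hne : ∀ z ∈ Metric.ball (0 : ℂ) 1, deriv h z ≠ 0)
    (hre : ∀ z ∈ Metric.ball (0 : ℂ) 1,
      -(1 / 2 : ℝ) < (1 + z * deriv (deriv h) z / deriv h z).re)
    {z l : ℂ} (hz0 : z ≠ 0) {R : ℝ} (hR1 : R < 1) (hR : R ^ 2 + 10 * R - 7 < 0) (hz : ‖z‖ < R)
    (hl : ‖l‖ ≤ 1) :
    0 < ((z * deriv h z + l * (z * deriv g z)) * (starRingEnd ℂ) (h z + l * g z)).re := by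
  obtain ⟨q, hq, hqne, hqre, hq3⟩ := exists_cube_root hh hne hre
  have hz1 : ‖z‖ < 1 := hz.trans hR1
  have hzm : z ∈ Metric.ball (0 : ℂ) 1 := mem_ball_zero_iff.2 hz1
  set c := (starRingEnd ℂ) z with hc
  have hcz : c * z = ((‖z‖ ^ 2 : ℝ) : ℂ) := by
    rw [hc, ← normSq_eq_conj_mul_self, normSq_eq_norm_sq]
  have hr0 : 0 < 1 - ‖z‖ ^ 2 := by nlinarith [norm_nonneg z]
  have hlz : 1 + l * z ≠ 0 := fun he => by
    have h1 : ‖l * z‖ = 1 := by rw [show l * z = -1 by linear_combination he]; simp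
    rw [norm_mul] at h1
    nlinarith [norm_nonneg z, norm_nonneg l]
  set l' := (c + l) / (1 + l * z) with hl'
  have hl'1 : ‖l'‖ ≤ 1 := by
    rw [hl', norm_div]
    refine div_le_one_of_le₀ (le_of_sq_le_sq ?_ (norm_nonneg _)) (norm_nonneg _)
    have h1 : 0 ≤ (1 - ‖z‖ ^ 2) * (1 - ‖l‖ ^ 2) :=
      mul_nonneg hr0.le (by nlinarith [norm_nonneg l])
    simp only [← normSq_eq_norm_sq, normSq_apply] at h1 ⊢
    simp only [hc, add_re, add_im, one_re, one_im, mul_re, mul_im, conj_re, conj_im]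
    nlinarith
  set Q := koebe q z with hQ
  have hQd : DifferentiableOn ℂ Q (Metric.ball 0 1) := differentiableOn_koebe hq hqne hzm
  have hQ0 : Q 0 = 1 := by simp [hQ, koebe, hqne z hzm]
  have hI := re_integral_cube_pos hQd hQ0 (fun ζ hζ => koebe_re_gt hq hqne hqre hzm hζ)
    (z := -z) (u := l' * z) hR1 hR (by rwa [norm_neg]) (by
      rw [norm_mul]
      nlinarith [norm_nonneg z, norm_nonneg l'])
  set J := ∫ t in (0 : ℝ)..1, (1 - t * (l' * z)) * Q (t * -z) ^ 3 with hJ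
  -- the radial segment from `z` to `0`, in the parametrization of the Koebe transform
  have hden : ∀ t ∈ Icc (0 : ℝ) 1, 1 - t * (c * z) ≠ 0 := fun t ht =>
    one_sub_mul_ne_zero (by rw [norm_mul, hc, norm_conj]; nlinarith [norm_nonneg z]) ht
  have hmem : ∀ t ∈ Icc (0 : ℝ) 1, ‖(t : ℂ) * -z‖ < 1 := fun t ht => by
    rw [norm_mul, norm_neg, norm_real, Real.norm_of_nonneg ht.1]
    nlinarith [norm_nonneg z, ht.2]
  have hγm : ∀ t ∈ Icc (0 : ℝ) 1, (1 - t) * z / (1 - t * (c * z)) ∈ Metric.ball (0 : ℂ) 1 :=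
    fun t ht => by
      have h1 := moebius_mem_ball hz1 (hmem t ht)
      convert h1 using 1
      congr 1 <;> ring
  have hFd : ∀ w ∈ Metric.ball (0 : ℂ) 1,
      HasDerivAt (fun w => h w + l * g w) ((1 + l * w) * q w ^ 3) w := fun w hw => by
    have h1 := (hh.differentiableAt (Metric.isOpen_ball.mem_nhds hw)).hasDerivAt
    have h2 := (hg.differentiableAt (Metric.isOpen_ball.mem_nhds hw)).hasDerivAt
    refine (h1.add (h2.const_mul l)).congr_deriv ?_
    rw [hgh w hw, hq3 w hw]
    ring
  have hd : ∀ t ∈ uIcc (0 : ℝ) 1, HasDerivAt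
      (fun t : ℝ => (fun w => h w + l * g w) ((1 - t) * z / (1 - t * (c * z))))
      (-(z * (1 - c * z) * ((1 + l * z) * q z ^ 3)) *
        ((1 - t * (l' * z)) * Q (t * -z) ^ 3)) t := by
    intro t ht
    rw [uIcc_of_le zero_le_one] at ht
    have hD := hden t ht
    have h1 : HasDerivAt (fun t : ℂ => t) 1 (t : ℂ) := hasDerivAt_id _
    have h2 := ((h1.const_sub 1).mul_const z).div ((h1.mul_const (c * z)).const_sub 1) hD
    have h3 := ((hFd _ (hγm t ht)).comp (t : ℂ) h2).comp_ofReal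
    refine h3.congr_deriv ?_
    have hQt : Q (t * -z) = q ((1 - t) * z / (1 - t * (c * z))) / (q z * (1 - t * (c * z))) := by
      have e1 : (t : ℂ) * -z + z = (1 - t) * z := by ring
      have e2 : 1 + c * ((t : ℂ) * -z) = 1 - t * (c * z) := by ring
      rw [hQ, koebe, ← hc, e1, e2]
    have hqz := hqne z hzm
    rw [hQt, hl']
    exact radial_koebe_identity rfl hD hlz hqz
  have hcont : ContinuousOn (fun t : ℝ => -(z * (1 - c * z) * ((1 + l * z) * q z ^ 3)) *
      ((1 - t * (l' * z)) * Q (t * -z) ^ 3)) (uIcc 0 1) := by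
    rw [uIcc_of_le zero_le_one]
    refine continuousOn_const.mul (ContinuousOn.mul (by fun_prop) (ContinuousOn.pow ?_ 3))
    exact hQd.continuousOn.comp (by fun_prop) fun t ht => mem_ball_zero_iff.2 (hmem t ht)
  have hint := intervalIntegral.integral_eq_sub_of_hasDerivAt hd hcont.intervalIntegrable
  rw [intervalIntegral.integral_const_mul, ← hJ] at hint
  -- F(z) = (1 - |z|²) z F'(z) J, so the sign of Re (z F' conj F) is that of Re J.
  have hFz : h z + l * g z =
      ((1 - ‖z‖ ^ 2 : ℝ) : ℂ) * (z * deriv h z + l * (z * deriv g z)) * J := by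
    simp only [ofReal_one, sub_self, zero_mul, zero_div, h0, g0, ofReal_zero, sub_zero, one_mul,
      div_one, mul_zero, add_zero, zero_sub] at hint
    rw [hgh z hzm, ← hq3 z hzm, ofReal_sub, ← hcz, ofReal_one]
    linear_combination hint
  have hA : z * deriv h z + l * (z * deriv g z) ≠ 0 := by
    rw [hgh z hzm, show z * deriv h z + l * (z * (z * deriv h z)) =
      z * deriv h z * (1 + l * z) by ring]
    exact mul_ne_zero (mul_ne_zero hz0 (hne z hzm)) hlz
  set A := z * deriv h z + l * (z * deriv g z)
  have h1 : A * (starRingEnd ℂ) (h z + l * g z) =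
      (((1 - ‖z‖ ^ 2) * normSq A : ℝ) : ℂ) * (starRingEnd ℂ) J := by
    rw [hFz, map_mul, map_mul, conj_ofReal, ofReal_mul, normSq_eq_conj_mul_self]
    ring
  rw [h1, re_ofReal_mul, conj_re]
  exact mul_pos (mul_pos hr0 (normSq_pos.2 hA)) hI

theorem isStarlikeOnDisk_of_mem_classM {f : ℂ → ℂ} (hf : f ∈ classM 1) {ρ : ℝ} (hρ : 0 < ρ)
    (hρ1 : ρ < 1) (hρR : ρ ^ 2 + 10 * ρ - 7 ≤ 0) : IsStarlikeOnDisk f ρ := by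
  obtain ⟨h, g, hh, hg, h0, g0, -, hall⟩ := hf
  have hsub : Metric.ball (0 : ℂ) ρ ⊆ Metric.ball 0 1 := Metric.ball_subset_ball hρ1.le
  have hst : IsStarlikeOnDisk (fun z => h z + (starRingEnd ℂ) (g z)) ρ := by
    refine isStarlikeOnDisk_of_harmonic (h' := deriv h) (g' := deriv g) (R := ρ) h0 g0 ?_ ?_ ?_ ?_
      hρ le_rfl
    · exact fun z hz =>
        (hh.analyticAt (Metric.isOpen_ball.mem_nhds (hsub hz))).hasStrictDerivAt
    · exact fun z hz =>
        (hg.analyticAt (Metric.isOpen_ball.mem_nhds (hsub hz))).hasStrictDerivAt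
    · intro z hz
      obtain ⟨-, h2, h3, -⟩ := hall z (hsub hz)
      rw [h2, one_mul, norm_mul]
      exact mul_lt_of_lt_one_left (norm_pos_iff.2 h3) (mem_ball_zero_iff.1 (hsub hz))
    · intro z hz hz0
      -- Only R² + 10 R - 7 < 0 is usable, while ρ may be the root itself; a radius between |z| and
      -- ρ restores strictness.
      obtain ⟨R, hzR, hRρ⟩ := exists_between (mem_ball_zero_iff.1 hz)
      have hR0 : 0 < R := (norm_nonneg z).trans_lt hzR
      exact re_harmonic_pos_of_stable fun l hl =>
        re_analytic_pos hh hg h0 g0 (fun w hw => by rw [(hall w hw).2.1, one_mul])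
          (fun w hw => (hall w hw).2.2.1) (fun w hw => (hall w hw).2.2.2) hz0 (hRρ.trans hρ1)
          (by nlinarith) hzR hl
  have heq : EqOn (fun z => h z + (starRingEnd ℂ) (g z)) f (disk ρ) := fun z hz =>
    (hall z (hsub hz)).1.symm
  exact ⟨hst.1.congr heq, heq.image_eq ▸ hst.2⟩

/-! ### The image of a disk under F -/

/-- The plane region that is the image of a disk under `mapF`. -/
def regionF (σ : ℝ) : Set ℂ :=
  {p | σ * (p.re + 2 * p.im ^ 2 + 1 / 2) ^ 2 < p.re + p.im ^ 2 + 1 / 4}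

theorem one_sub_ne_zero_of_norm_lt {z : ℂ} (hz : ‖z‖ < 1) : 1 - z ≠ 0 := by
  simpa using one_sub_mul_ne_zero hz (t := 1) (by simp)

theorem mapF_eq {z : ℂ} (hz : ‖z‖ < 1) :
    (mapF z).re = (z / (1 - z)).re + (z / (1 - z)).re ^ 2 - (z / (1 - z)).im ^ 2 ∧
      (mapF z).im = (z / (1 - z)).im := by
  have hz' := one_sub_ne_zero_of_norm_lt hz
  have h1 : z / (1 - z) ^ 2 = z / (1 - z) + z / (1 - z) * (z / (1 - z)) := by
    field_simp
    ring
  unfold mapF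
  rw [h1]
  generalize z / (1 - z) = w
  constructor
  · simp
    ring
  · simp

/-- The half-plane coordinate `w = z / (1 - z)` of a point of the disk `|z| < r`. -/
theorem norm_lt_iff_cayley {w : ℂ} (hw : 0 < w.re + 1 / 2) {r : ℝ} (hr : 0 < r) :
    ‖w / (1 + w)‖ < r ↔
      (1 - r ^ 2) * ((w.re + 1 / 2) ^ 2 + w.im ^ 2 + 1 / 4) < (1 + r ^ 2) * (w.re + 1 / 2) := by
  have h1 : 1 + w ≠ 0 := fun h => by
    have := congrArg re h
    simp at this
    linarith
  rw [norm_div, div_lt_iff₀ (norm_pos_iff.2 h1),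
    ← pow_lt_pow_iff_left₀ (norm_nonneg _) (by positivity) two_ne_zero, mul_pow,
    ← normSq_eq_norm_sq, ← normSq_eq_norm_sq, normSq_apply, normSq_apply]
  simp only [add_re, add_im, one_re, one_im]
  constructor <;> intro h <;> nlinarith

theorem cayley_re_pos {z : ℂ} (hz : ‖z‖ < 1) : 0 < (z / (1 - z)).re + 1 / 2 := by
  have h1 := normSq_pos.2 (one_sub_ne_zero_of_norm_lt hz)
  have h2 := pow_lt_pow_left₀ hz (norm_nonneg _) two_ne_zero
  have h3 : (z / (1 - z)).re + 1 / 2 = (1 - normSq z) / (2 * normSq (1 - z)) := by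
    rw [div_re, ← add_div, div_add_div _ _ h1.ne' two_ne_zero,
      div_eq_div_iff (by positivity) (by positivity)]
    simp only [normSq_apply, sub_re, sub_im, one_re, one_im]
    ring
  rw [h3]
  rw [← normSq_eq_norm_sq] at h2
  exact div_pos (by linarith) (by positivity)

theorem cayley_inverse {z : ℂ} (hz : ‖z‖ < 1) : z / (1 - z) / (1 + z / (1 - z)) = z := by
  have h1 := one_sub_ne_zero_of_norm_lt hz
  have h2 : 1 + z / (1 - z) = 1 / (1 - z) := by
    field_simp
    ring
  rw [h2]
  field_simp

/-- With w = z / (1 - z) and A = Re w + 1/2 > 0, a point p = F(z) has Im p = Im w and A² = Re p +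
(Im p)² + 1/4. So p determines z, and squaring the disk condition of `norm_lt_iff_cayley` gives the
region; r = 1 is the case σ = 0. -/
theorem image_mapF {r : ℝ} (hr0 : 0 < r) (hr1 : r ≤ 1) :
    mapF '' disk r = regionF (((1 - r ^ 2) / (1 + r ^ 2)) ^ 2) := by
  have hs0 : 0 ≤ (1 - r ^ 2) / (1 + r ^ 2) := div_nonneg (by nlinarith) (by positivity)
  have hkey : ∀ A m : ℝ, 0 < A → 0 < m →
      ((1 - r ^ 2) * m < (1 + r ^ 2) * A ↔ ((1 - r ^ 2) / (1 + r ^ 2)) ^ 2 * m ^ 2 < A ^ 2) := by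
    intro A m hA hm
    rw [← mul_pow, pow_lt_pow_iff_left₀ (by positivity) hA.le two_ne_zero, div_mul_eq_mul_div,
      div_lt_iff₀ (by positivity), mul_comm A]
  ext p
  constructor
  · rintro ⟨z, hz, rfl⟩
    have hz : ‖z‖ < r := by simpa [disk] using hz
    have hz1 := hz.trans_le hr1
    obtain ⟨h1, h2⟩ := mapF_eq hz1
    have hA := cayley_re_pos hz1
    rw [← cayley_inverse hz1, norm_lt_iff_cayley hA hr0, hkey _ _ hA (by positivity)] at hz
    simp only [regionF, mem_ofPred_eq, h1, h2]
    convert hz using 1 <;> ring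
  · intro hp
    simp only [regionF, mem_ofPred_eq] at hp
    have hA2 : 0 < p.re + p.im ^ 2 + 1 / 4 := lt_of_le_of_lt (by positivity) hp
    set A := Real.sqrt (p.re + p.im ^ 2 + 1 / 4) with hAdef
    have hA : 0 < A := Real.sqrt_pos.2 hA2
    have hAsq : A ^ 2 = p.re + p.im ^ 2 + 1 / 4 := Real.sq_sqrt hA2.le
    set w : ℂ := ⟨A - 1 / 2, p.im⟩ with hw
    have hwA : w.re + 1 / 2 = A := by simp [hw]
    have hw1 : 1 + w ≠ 0 := fun h => by
      have := congrArg re h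
      simp [hw] at this
      linarith
    have hr : ‖w / (1 + w)‖ < r := by
      rw [norm_lt_iff_cayley (by rwa [hwA]) hr0, hwA, hkey _ _ hA (by positivity), hAsq]
      convert hp using 1
      simp only [hw]
      ring
    have hz1 := hr.trans_le hr1
    have hinv : w / (1 + w) / (1 - w / (1 + w)) = w := by
      have h2 : 1 - w / (1 + w) = 1 / (1 + w) := by
        field_simp
        ring
      rw [h2]
      field_simp
    refine ⟨w / (1 + w), by simpa [disk] using hr, ?_⟩
    obtain ⟨h1, h2⟩ := mapF_eq hz1
    rw [hinv] at h1 h2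
    apply Complex.ext
    · rw [h1]
      simp only [hw]
      nlinarith
    · rw [h2]

theorem injOn_mapF : InjOn mapF (disk 1) := by
  intro a ha b hb hab
  have ha : ‖a‖ < 1 := by simpa [disk] using ha
  have hb : ‖b‖ < 1 := by simpa [disk] using hb
  obtain ⟨h1, h2⟩ := mapF_eq ha
  obtain ⟨h3, h4⟩ := mapF_eq hb
  rw [hab] at h1 h2
  have hA := cayley_re_pos ha
  have hB := cayley_re_pos hb
  have him : (a / (1 - a)).im = (b / (1 - b)).im := by rw [← h2, h4]
  have hre : (a / (1 - a)).re = (b / (1 - b)).re := by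
    have h5 : ((a / (1 - a)).re - (b / (1 - b)).re) *
        ((a / (1 - a)).re + 1 / 2 + ((b / (1 - b)).re + 1 / 2)) = 0 := by
      rw [him] at h1
      linarith
    rcases mul_eq_zero.1 h5 with h | h <;> linarith
  rw [← cayley_inverse ha, ← cayley_inverse hb, Complex.ext hre him]

theorem isOpen_regionF (σ : ℝ) : IsOpen (regionF σ) :=
  isOpen_lt (by fun_prop) (by fun_prop)

/-! ### Rays in the image region and the threshold 5/32 -/

/-- The defining function of `regionF σ` along the ray through the point `X + i y`, `Y = y ^ 2`. -/
noncomputable def rayF (σ X Y t : ℝ) : ℝ :=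
  t * X + t ^ 2 * Y + 1 / 4 - σ * (t * X + 2 * (t ^ 2 * Y) + 1 / 2) ^ 2

theorem smul_mem_regionF {σ t : ℝ} {p : ℂ} :
    t • p ∈ regionF σ ↔ 0 < rayF σ p.re (p.im ^ 2) t := by
  simp only [regionF, rayF, mem_ofPred_eq, real_smul, re_ofReal_mul, im_ofReal_mul, mul_pow, sub_pos]

theorem hasDerivAt_rayF (σ X Y t : ℝ) : HasDerivAt (rayF σ X Y)
    (X + 2 * t * Y - 2 * σ * (t * X + 2 * (t ^ 2 * Y) + 1 / 2) * (X + 4 * t * Y)) t := by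
  have h1 := hasDerivAt_id t
  have h2 := ((h1.mul_const X).add ((h1.pow 2).mul_const Y)).add_const (1 / 4)
  have h3 := (((h1.mul_const X).add (((h1.pow 2).mul_const Y).const_mul 2)).add_const (1 / 2)).pow 2
  refine (h2.sub (h3.const_mul σ)).congr_deriv ?_
  simp
  ring

/-- The expression is convex in τ, so it lies below its chord between τ = 5m²/32 and τ = m - 1/4.
The end values are -(m/256)(5m - 4)²(8 - m) and -(m - 1/2)²; the first vanishes at m = 4/5, which
makes 5/32 critical. -/
theorem quadratic_neg {m τ : ℝ} (h1 : 5 * m ^ 2 / 32 < τ) (h2 : τ ≤ m - 1 / 4)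
    (hm : τ < m - 1 / 4 ∨ m ≠ 1 / 2) :
    4 * τ ^ 2 - 6 * τ * m + m ^ 2 + 2 * τ - m / 2 < 0 := by
  have hm8 : m < 8 := by nlinarith
  have hm0 : 0 < m := by nlinarith [sq_nonneg m]
  set a := 5 * m ^ 2 / 32 with ha
  have hg0 : 4 * a ^ 2 - 6 * a * m + m ^ 2 + 2 * a - m / 2 ≤ 0 := by
    have : 4 * a ^ 2 - 6 * a * m + m ^ 2 + 2 * a - m / 2 =
        -(m / 256 * ((5 * m - 4) ^ 2 * (8 - m))) := by
      rw [ha]; ring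
    rw [this, neg_nonpos]
    have : 0 < 8 - m := by linarith
    positivity
  have hd : 0 < m - 1 / 4 - a := by linarith
  have h3 : (m - 1 / 4 - a) * (4 * τ ^ 2 - 6 * τ * m + m ^ 2 + 2 * τ - m / 2) =
      -(4 * (τ - a) * (m - 1 / 4 - τ) * (m - 1 / 4 - a)) +
        (m - 1 / 4 - τ) * (4 * a ^ 2 - 6 * a * m + m ^ 2 + 2 * a - m / 2) -
        (τ - a) * (m - 1 / 2) ^ 2 := by ring
  have hτa : 0 < τ - a := sub_pos.2 h1
  have h4 : 0 < 4 * (τ - a) * (m - 1 / 4 - τ) * (m - 1 / 4 - a) + (τ - a) * (m - 1 / 2) ^ 2 := by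
    rcases hm with h | h
    · have := sub_pos.2 h
      positivity
    · have h6 := sub_ne_zero.2 h
      have := sub_nonneg.2 h2
      positivity
  have h5 := mul_nonpos_of_nonneg_of_nonpos (sub_nonneg.2 h2) hg0
  by_contra! hcon
  have := mul_nonneg hd.le hcon
  linarith

/-- At a zero, with m = t X + 2 t² Y + 1/2 and τ = σ m², one has t² Y = m - 1/4 - τ, and m t times
the derivative is the expression in `quadratic_neg`. The degenerate case m = 1/2, τ = 1/4 is
excluded by σ < 1. -/
theorem rayF_deriv_neg {σ X Y t : ℝ} (hσ : 5 / 32 < σ) (hσ1 : σ < 1) (hY : 0 ≤ Y) (ht : 0 < t)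
    (h0 : rayF σ X Y t = 0) :
    X + 2 * t * Y - 2 * σ * (t * X + 2 * (t ^ 2 * Y) + 1 / 2) * (X + 4 * t * Y) < 0 := by
  unfold rayF at h0
  set y := t ^ 2 * Y with hy
  have hy0 : 0 ≤ y := by positivity
  obtain ⟨m, hm⟩ : ∃ m, m = t * X + 2 * y + 1 / 2 := ⟨_, rfl⟩
  rw [← hm] at h0 ⊢
  have h1 : y = m - 1 / 4 - σ * m ^ 2 := by linarith
  have hm0 : 0 < m := by nlinarith [sq_nonneg m]
  have hmne : σ * m ^ 2 < m - 1 / 4 ∨ m ≠ 1 / 2 := by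
    by_cases h : m = 1 / 2
    · left
      rw [h]
      linarith
    · exact Or.inr h
  have h2 := quadratic_neg (m := m) (τ := σ * m ^ 2) (by nlinarith [pow_pos hm0 2]) (by linarith)
    hmne
  have h3 : m * t * (X + 2 * t * Y - 2 * σ * m * (X + 4 * t * Y)) =
      4 * (σ * m ^ 2) ^ 2 - 6 * (σ * m ^ 2) * m + m ^ 2 + 2 * (σ * m ^ 2) - m / 2 := by
    have e1 : t * X = m - 1 / 2 - 2 * y := by linarith
    have e2 : m * t * (X + 2 * t * Y - 2 * σ * m * (X + 4 * t * Y)) =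
        m * (t * X + 2 * y - 2 * σ * m * (t * X + 4 * y)) := by rw [hy]; ring
    rw [e2, e1, h1]
    ring
  rw [← h3] at h2
  exact neg_of_mul_neg_right h2 (by positivity)

/-- At the last nonpositive parameter before 1 the function would remain nonpositive a little to the
right, because it crosses its zeros only downwards. -/
theorem rayF_pos {σ X Y t : ℝ} (hσ : 5 / 32 < σ) (hσ1 : σ < 1) (hY : 0 ≤ Y) (h1 : 0 < rayF σ X Y 1)
    (ht0 : 0 ≤ t) (ht1 : t ≤ 1) : 0 < rayF σ X Y t := by
  by_contra! hcon
  have hc : Continuous (rayF σ X Y) := by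
    unfold rayF
    fun_prop
  have ht : 0 < t := lt_of_le_of_ne ht0 fun h => by
    rw [← h] at hcon
    unfold rayF at hcon
    linarith
  have hS : IsCompact (Icc t 1 ∩ rayF σ X Y ⁻¹' Iic 0) :=
    isCompact_Icc.inter_right (isClosed_Iic.preimage hc)
  obtain ⟨m, ⟨⟨hm1, hm2⟩, hm3⟩, hmax⟩ := hS.exists_isGreatest ⟨t, ⟨le_rfl, ht1⟩, hcon⟩
  have hm3 : rayF σ X Y m ≤ 0 := hm3
  have hm1' : m < 1 := lt_of_le_of_ne hm2 fun h => by
    rw [h] at hm3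
    linarith
  have hev : ∀ᶠ s in 𝓝[>] m, rayF σ X Y s ≤ 0 := by
    rcases hm3.lt_or_eq with h | h
    · exact ((hc.tendsto m).eventually (gt_mem_nhds h)).filter_mono nhdsWithin_le_nhds |>.mono
        fun s hs => le_of_lt hs
    · have := eventually_lt_right_of_hasDerivAt_neg (hasDerivAt_rayF σ X Y m)
        (rayF_deriv_neg hσ hσ1 hY (ht.trans_le hm1) h)
      rw [h] at this
      exact this.mono fun s hs => le_of_lt hs
  obtain ⟨s, hs1, hs2⟩ := (hev.and (Ioo_mem_nhdsGT hm1')).exists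
  exact absurd (hmax ⟨⟨hm1.trans hs2.1.le, hs2.2.le⟩, hs1⟩) (not_le.2 hs2.1)

theorem starConvex_regionF {σ : ℝ} (hσ : 5 / 32 < σ) (hσ1 : σ < 1) :
    StarConvex ℝ (0 : ℂ) (regionF σ) := by
  rw [starConvex_zero_iff]
  intro p hp t ht0 ht1
  rw [← one_smul ℝ p, smul_mem_regionF] at hp
  rw [smul_mem_regionF]
  exact rayF_pos hσ hσ1 (sq_nonneg _) hp ht0 ht1

/-- The chosen boundary point has m = 4/5, the critical value in `quadratic_neg`. With τ = 16σ/25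
the expression there is 4(τ - 1/10)(τ - 3/5), positive for σ < 5/32, so the ray leaves the region
just before this point. Shifting the point by a small η > 0 puts it inside, with an earlier point of
its ray still outside. -/
theorem not_starConvex_regionF {σ : ℝ} (hσ0 : 0 ≤ σ) (hσ : σ < 5 / 32) :
    ¬ StarConvex ℝ (0 : ℂ) (regionF σ) := by
  rw [starConvex_zero_iff]
  intro hstar
  -- the boundary point at which the boundary curve turns back
  set X := 32 / 25 * σ - 4 / 5 with hX
  set Y := 11 / 20 - 16 / 25 * σ with hY
  have hY0 : 0 ≤ Y := by linarith
  have hP1 : rayF σ X Y 1 = 0 := by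
    unfold rayF
    rw [hX, hY]
    ring
  have hd := eventually_lt_left_of_hasDerivAt_pos (hasDerivAt_rayF σ X Y 1) (by
    rw [hX, hY]
    nlinarith)
  rw [hP1] at hd
  obtain ⟨t, ht, ht0, ht1⟩ := (hd.and (Ioo_mem_nhdsLT (zero_lt_one (α := ℝ)))).exists
  have hc : Continuous fun η : ℝ => rayF σ (X + η) Y t := by
    unfold rayF
    fun_prop
  have hη : ∀ᶠ η in 𝓝[>] (0 : ℝ), rayF σ (X + η) Y t < 0 :=
    (hc.tendsto 0).eventually (gt_mem_nhds (by simpa using ht)) |>.filter_mono nhdsWithin_le_nhds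
  obtain ⟨η, hη1, hη2, hη3⟩ := (hη.and (Ioo_mem_nhdsGT (zero_lt_one (α := ℝ)))).exists
  have hmem : (⟨X + η, Real.sqrt Y⟩ : ℂ) ∈ regionF σ := by
    rw [← one_smul ℝ (⟨X + η, Real.sqrt Y⟩ : ℂ), smul_mem_regionF]
    simp only [Real.sq_sqrt hY0]
    have : rayF σ (X + η) Y 1 = η * (1 - 8 / 5 * σ - σ * η) := by
      unfold rayF
      rw [hX, hY]
      ring
    rw [this]
    exact mul_pos hη2 (by nlinarith)
  have := hstar hmem ht0.le ht1.le
  rw [smul_mem_regionF] at this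
  simp only [Real.sq_sqrt hY0] at this
  linarith

/-! ### The radius r₀ and membership of F in the class -/

/-- With x = r², equality on the right reads 27x² - 74x + 27 = 0, whose root in (0, 1) is (37 -
8√10)/27 = r₀². -/
theorem le_radius_iff {r : ℝ} (hr0 : 0 < r) (hr1 : r ≤ 1) :
    r ≤ (1 / 3) * Real.sqrt ((1 / 3) * (37 - 8 * Real.sqrt 10)) ↔
      5 / 32 ≤ ((1 - r ^ 2) / (1 + r ^ 2)) ^ 2 := by
  have hk : Real.sqrt 10 ^ 2 = 10 := Real.sq_sqrt (by norm_num)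
  have hk0 : 0 ≤ Real.sqrt 10 := Real.sqrt_nonneg _
  set k := Real.sqrt 10
  have h1 : r ≤ (1 / 3) * Real.sqrt ((1 / 3) * (37 - 8 * k)) ↔ 27 * r ^ 2 ≤ 37 - 8 * k := by
    rw [show r ≤ (1 / 3) * Real.sqrt ((1 / 3) * (37 - 8 * k)) ↔
      3 * r ≤ Real.sqrt ((1 / 3) * (37 - 8 * k)) by constructor <;> intro h <;> linarith,
      Real.le_sqrt' (by positivity)]
    constructor <;> intro h <;> linarith
  rw [h1, div_pow, div_le_div_iff₀ (by norm_num) (by positivity)]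
  have hr2 : r ^ 2 ≤ 1 := by nlinarith
  constructor
  · intro h
    nlinarith
  · intro h
    have h2 : (8 * k) ^ 2 ≤ (37 - 27 * r ^ 2) ^ 2 := by nlinarith
    have := abs_le_of_sq_le_sq' h2 (by linarith)
    linarith [this.2]

theorem starlike_ratio_lt {r r' : ℝ} (h0 : 0 < r') (h : r' < r) (h1 : r ≤ 1) :
    ((1 - r ^ 2) / (1 + r ^ 2)) ^ 2 < ((1 - r' ^ 2) / (1 + r' ^ 2)) ^ 2 := by
  have hr : r' ^ 2 < r ^ 2 := by nlinarith
  have hr1 : r ^ 2 ≤ 1 := by nlinarith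
  refine pow_lt_pow_left₀ ?_ (div_nonneg (by linarith) (by positivity)) two_ne_zero
  rw [div_lt_div_iff₀ (by positivity) (by positivity)]
  nlinarith

theorem isStarlikeDomain_image_mapF_iff {r : ℝ} (hr0 : 0 < r) (hr1 : r ≤ 1) :
    IsStarlikeDomain (mapF '' disk r) ↔
      r ≤ (1 / 3) * Real.sqrt ((1 / 3) * (37 - 8 * Real.sqrt 10)) := by
  rw [le_radius_iff hr0 hr1]
  constructor
  · rintro ⟨-, -, h⟩
    by_contra! hlt
    rw [image_mapF hr0 hr1] at h
    exact not_starConvex_regionF (by positivity) hlt h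
  · intro h
    refine ⟨by rw [image_mapF hr0 hr1]; exact isOpen_regionF _,
      ⟨0, by simpa [disk] using hr0, by simp [mapF]⟩, ?_⟩
    rw [starConvex_zero_iff]
    rintro _ ⟨z, hz, rfl⟩ t ht0 ht1
    -- the disk is the union of smaller ones, which satisfy the strict inequality
    obtain ⟨r', hr'1, hr'2⟩ := exists_between (max_lt (by simpa [disk] using hz : ‖z‖ < r) hr0)
    have hr'0 : 0 < r' := (le_max_right _ _).trans_lt hr'1
    have hzr' : z ∈ disk r' := by simpa [disk] using (le_max_left _ _).trans_lt hr'1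
    have hst : StarConvex ℝ (0 : ℂ) (mapF '' disk r') := by
      rw [image_mapF hr'0 (hr'2.le.trans hr1)]
      refine starConvex_regionF (h.trans_lt (starlike_ratio_lt hr'0 hr'2 hr1)) ?_
      have h1 : (1 - r' ^ 2) / (1 + r' ^ 2) < 1 := by
        rw [div_lt_one (by positivity)]
        nlinarith
      have h2 : 0 ≤ (1 - r' ^ 2) / (1 + r' ^ 2) := div_nonneg (by nlinarith) (by positivity)
      nlinarith
    exact image_mono (Metric.ball_subset_ball hr'2.le)
      (starConvex_zero_iff.1 hst (mem_image_of_mem _ hzr') ht0 ht1)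

/-- Here h + g = z/(1 - z)² and h - g = z/(1 - z), so h' = (1 - z)⁻³ and 1 + z h''/h' = 1 + 3z/(1 -
z). The bound -1/2 is then Re (z/(1 - z)) > -1/2. -/
theorem mapF_mem_classM : mapF ∈ classM 1 := by
  have hne : ∀ z ∈ disk 1, 1 - z ≠ 0 := fun z hz =>
    one_sub_ne_zero_of_norm_lt (by simpa [disk] using hz)
  have hd1 : ∀ z : ℂ, HasDerivAt (fun z : ℂ => 1 - z) (-1) z := fun z => by
    simpa using (hasDerivAt_id z).const_sub 1
  have hh : ∀ z ∈ disk 1, HasDerivAt (fun z : ℂ => (z - z ^ 2 / 2) / (1 - z) ^ 2)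
      (1 / (1 - z) ^ 3) z := fun z hz => by
    have h0 := hne z hz
    have h1 := ((hasDerivAt_id z).sub (((hasDerivAt_id z).pow 2).div_const 2)).div
      ((hd1 z).pow 2) (pow_ne_zero 2 h0)
    refine h1.congr_deriv ?_
    simp only [Pi.sub_apply, Pi.pow_apply, id_eq]
    rw [div_eq_div_iff (pow_ne_zero 2 (pow_ne_zero 2 h0)) (pow_ne_zero 3 h0)]
    push_cast
    ring
  have hg : ∀ z ∈ disk 1, HasDerivAt (fun z : ℂ => z ^ 2 / 2 / (1 - z) ^ 2)
      (z / (1 - z) ^ 3) z := fun z hz => by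
    have h0 := hne z hz
    have h1 := (((hasDerivAt_id z).pow 2).div_const 2).div ((hd1 z).pow 2) (pow_ne_zero 2 h0)
    refine h1.congr_deriv ?_
    simp only [Pi.pow_apply, id_eq]
    rw [div_eq_div_iff (pow_ne_zero 2 (pow_ne_zero 2 h0)) (pow_ne_zero 3 h0)]
    push_cast
    ring
  have hopen : IsOpen (disk 1) := Metric.isOpen_ball
  have h0mem : (0 : ℂ) ∈ disk 1 := by simp [disk]
  have hh2 : ∀ z ∈ disk 1, deriv (deriv fun z : ℂ => (z - z ^ 2 / 2) / (1 - z) ^ 2) z =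
      3 / (1 - z) ^ 4 := fun z hz => by
    have h0 := hne z hz
    have h1 : deriv (fun z : ℂ => (z - z ^ 2 / 2) / (1 - z) ^ 2) =ᶠ[𝓝 z]
        fun z => 1 / (1 - z) ^ 3 := by
      filter_upwards [hopen.mem_nhds hz] with w hw using (hh w hw).deriv
    have h2 := (hasDerivAt_const z (1 : ℂ)).div ((hd1 z).pow 3) (pow_ne_zero 3 h0)
    rw [h1.deriv_eq]
    refine h2.deriv.trans ?_
    simp only [Pi.pow_apply]
    rw [div_eq_div_iff (pow_ne_zero 2 (pow_ne_zero 3 h0)) (pow_ne_zero 4 h0)]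
    push_cast
    ring
  refine ⟨fun z => (z - z ^ 2 / 2) / (1 - z) ^ 2, fun z => z ^ 2 / 2 / (1 - z) ^ 2,
    fun z hz => (hh z hz).differentiableAt.differentiableWithinAt,
    fun z hz => (hg z hz).differentiableAt.differentiableWithinAt, by simp, by simp,
    by rw [(hh 0 h0mem).deriv]; simp, fun z hz => ?_⟩
  have h0 := hne z hz
  have hz1 : ‖z‖ < 1 := by simpa [disk] using hz
  rw [(hh z hz).deriv, (hg z hz).deriv, hh2 z hz]
  refine ⟨?_, by ring, one_div_ne_zero (pow_ne_zero 3 h0), ?_⟩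
  · have e1 : z / (1 - z) ^ 2 = (z - z ^ 2 / 2) / (1 - z) ^ 2 + z ^ 2 / 2 / (1 - z) ^ 2 := by
      rw [← add_div]
      ring
    have e2 : z / (1 - z) = (z - z ^ 2 / 2) / (1 - z) ^ 2 - z ^ 2 / 2 / (1 - z) ^ 2 := by
      rw [← sub_div, div_eq_div_iff h0 (pow_ne_zero 2 h0)]
      ring
    change mapF z = (z - z ^ 2 / 2) / (1 - z) ^ 2 + (starRingEnd ℂ) (z ^ 2 / 2 / (1 - z) ^ 2)
    unfold mapF
    rw [e1, e2]
    generalize (z - z ^ 2 / 2) / (1 - z) ^ 2 = a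
    generalize z ^ 2 / 2 / (1 - z) ^ 2 = b
    apply Complex.ext <;> simp
    ring
  · have e1 : 1 + z * (3 / (1 - z) ^ 4) / (1 / (1 - z) ^ 3) =
        1 + ((3 : ℝ) : ℂ) * (z / (1 - z)) := by
      push_cast
      field_simp
    rw [e1, add_re, re_ofReal_mul, one_re]
    linarith [cayley_re_pos hz1]

theorem isStarlikeOnDisk_mapF_iff {r : ℝ} (hr0 : 0 < r) (hr1 : r ≤ 1) :
    IsStarlikeOnDisk mapF r ↔ r ≤ (1 / 3) * Real.sqrt ((1 / 3) * (37 - 8 * Real.sqrt 10)) := by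
  rw [← isStarlikeDomain_image_mapF_iff hr0 hr1]
  exact ⟨fun h => h.2, fun h => ⟨injOn_mapF.mono (Metric.ball_subset_ball hr1), h⟩⟩

theorem radius_pos_le_one : 0 < (1 / 3) * Real.sqrt ((1 / 3) * (37 - 8 * Real.sqrt 10)) ∧
    (1 / 3) * Real.sqrt ((1 / 3) * (37 - 8 * Real.sqrt 10)) ≤ 1 := by
  have hk : Real.sqrt 10 < 4 := by
    rw [Real.sqrt_lt' (by norm_num)]
    norm_num
  have hk0 : 0 ≤ Real.sqrt 10 := Real.sqrt_nonneg _
  constructor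
  · have : 0 < (1 / 3) * (37 - 8 * Real.sqrt 10) := by linarith
    have := Real.sqrt_pos.2 this
    positivity
  · have : Real.sqrt ((1 / 3) * (37 - 8 * Real.sqrt 10)) ≤ 4 := by
      rw [Real.sqrt_le_left (by norm_num)]
      linarith
    by_contra! h
    have h2 : (3 : ℝ) < Real.sqrt ((1 / 3) * (37 - 8 * Real.sqrt 10)) := by linarith
    rw [Real.lt_sqrt (by norm_num)] at h2
    nlinarith [Real.sq_sqrt (show (0 : ℝ) ≤ 10 by norm_num)]

theorem four_mul_sqrt_two_sub_five_pos_lt_one :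
    0 < 4 * Real.sqrt 2 - 5 ∧ 4 * Real.sqrt 2 - 5 < 1 := by
  have h1 : (5 / 4 : ℝ) < Real.sqrt 2 := by
    rw [Real.lt_sqrt (by norm_num)]
    norm_num
  have h2 : Real.sqrt 2 < 3 / 2 := by
    rw [Real.sqrt_lt' (by norm_num)]
    norm_num
  constructor <;> linarith

end HarmonicStarlike

open HarmonicStarlike in
theorem theorem3p9 :
    (4 * Real.sqrt 2 - 5 ≤ radiusOfStarlikeness (classM 1) ∧
      radiusOfStarlikeness (classM 1) ≤
        (1 / 3) * Real.sqrt ((1 / 3) * (37 - 8 * Real.sqrt 10))) ∧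
    mapF ∈ classM 1 ∧
    radiusOfStarlikeness {mapF} =
      (1 / 3) * Real.sqrt ((1 / 3) * (37 - 8 * Real.sqrt 10)) ∧
    (∀ r : ℝ, 0 < r → r ≤ 1 →
      (IsStarlikeDomain (mapF '' disk r) ↔
        r ≤ (1 / 3) * Real.sqrt ((1 / 3) * (37 - 8 * Real.sqrt 10)))) := by
  obtain ⟨hR0, hR1⟩ := four_mul_sqrt_two_sub_five_pos_lt_one
  have hsq : Real.sqrt 2 ^ 2 = 2 := Real.sq_sqrt (by norm_num)
  -- 4√2 - 5 is the positive root of r² + 10 r - 7, and the endpoint itself is admissible.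
  have hmem : 4 * Real.sqrt 2 - 5 ∈ {r : ℝ | 0 < r ∧ r ≤ 1 ∧
      ∀ f ∈ classM 1, ∀ ρ : ℝ, 0 < ρ → ρ ≤ r → IsStarlikeOnDisk f ρ} :=
    ⟨hR0, hR1.le, fun f hf ρ hρ hρR =>
      isStarlikeOnDisk_of_mem_classM hf hρ (hρR.trans_lt hR1) (by nlinarith)⟩
  obtain ⟨hr0, hr1⟩ := radius_pos_le_one
  refine ⟨⟨le_csSup ⟨1, fun r hr => hr.2.1⟩ hmem, csSup_le ⟨_, hmem⟩ fun r hr => ?_⟩,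
    mapF_mem_classM, IsGreatest.csSup_eq ⟨⟨hr0, hr1, fun f hf ρ hρ hρr => ?_⟩, fun r hr => ?_⟩,
    fun r h0 h1 => isStarlikeDomain_image_mapF_iff h0 h1⟩
  · exact (isStarlikeOnDisk_mapF_iff hr.1 hr.2.1).1 (hr.2.2 _ mapF_mem_classM r hr.1 le_rfl)
  · rw [Set.mem_singleton_iff.1 hf]
    exact (isStarlikeOnDisk_mapF_iff hρ (hρr.trans hr1)).2 hρr
  · exact (isStarlikeOnDisk_mapF_iff hr.1 hr.2.1).1 (hr.2.2 _ rfl r hr.1 le_rfl)
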